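/- Let $\mathbb K$ be a field of characteristic $0$ and $V=\bigoplus_{i\in\mathbb Z}V^i$ a graded $\mathbb K$-vector space. Let $\bar T(V)=\bigoplus_{n\ge1}V^{\otimes n}$ be the reduced tensor coalgebra, with coproduct $\mathfrak a(x_1\otimes\cdots\otimes x_n)=\sum_{i=1}^{n-1}(x_1\otimes\cdots\otimes x_i)\otimes(x_{i+1}\otimes\cdots\otimes x_n)$, and let $\bar S(V)=\bigoplus_{n\ge1}(V^{\otimes n})^{\Sigma_n}\subset\bar T(V)$ be the reduced symmetric coalgebra, where $\Sigma_n$ acts on $V^{\otimes n}$ with Koszul signs. It is a graded subcoalgebra of $\bar T(V)$. A codifferential of a graded coalgebra is a coderivation of degree $+1$ with square zero. The Koszul sign rule is used throughout. A contraction $(W\rightleftarrows V,k)$ of complexes $(W,d_W)$, $(V,d_V)$ (differentials of degree $+1$) consists of cochain maps $i\colon W\to V$, $p\colon V\to W$ and a map $k\colon V\to V$ of degree $-1$ with $pi=\mathrm{Id}_W$, $ip-\mathrm{Id}_V=d_Vk+kd_V$ and $pk=ki=k^2=0$. **Theorem.** Let $Q$ be a coderivation of degree $+1$ of $\bar T(V)$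 such that $Q^2=0$ on $\bar S(V)$. Let $d_1=Q|_V\colon V\to V$ be its linear part, let $d$ be the natural differential induced by $d_1$ on the tensor powers of $V$, and put $\partial=Q-d$. Let $(W\rightleftarrows V,k)$ be a contraction of complexes, with maps $i,p$ and differentials $d_W$ on $W$ and $d_1$ on $V$ (for instance, $W$ a differential graded subspace of $(V,d_1)$ and $i$ the inclusion). Denote also by $d$ the differential induced by $d_W$ on $\bar T(W)$. Then: 1. $d(V^{\otimes n})\subset V^{\otimes n}$ and $\partial(V^{\otimes n})\subset\bigoplus_{j=1}^{n-1}V^{\otimes j}$ for every $n\ge1$. 2. With $\imath=\sum_n i^{\otimes n}$, $\pi=\sum_n p^{\otimes n}$ and $h=Tk=\sum_{n\ge1}\sum_{j=1}^{n}(ip)^{\otimes j-1}\otimes k\otimes\mathrm{Id}_V^{\otimes n-j}$, the data $(\bar T(W)\rightleftarrows\bar T(V),h)$ form a coalgebra contraction: a contraction of complexes in which both differentials are codifferentials, $\imath$ and $\pi$ are morphisms of differential graded coalgebras, and $\mathfrak a h=(\imath\pi\otimes h+h\otimes\mathrm{Id})\mathfrak a$. 3. The sums $$\imath_\partial=\sum_{n\ge0}(h\partial)^n\imath\colon\bar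 T(W)\to\bar T(V),\qquad D_\partial=\sum_{n\ge0}\pi\partial(h\partial)^n\imath=\sum_{n\ge0}\pi(\partial h)^n\partial\imath\colon\bar T(W)\to\bar T(W)$$ are well defined (on every vector only finitely many terms are nonzero). The maps $d$ and $\partial$ send $\bar S(V)$ into itself, $d$ and $D_\partial$ send $\bar S(W)$ into itself, and $\imath_\partial(\bar S(W))\subset\bar S(V)$. 4. $d+\partial$ is a codifferential on $\bar S(V)$, $d+D_\partial$ is a codifferential on $\bar S(W)$, and $\imath_\partial\colon(\bar S(W),d+D_\partial)\to(\bar S(V),d+\partial)$ is a morphism of differential graded coalgebras: a morphism of graded coalgebras with $(d+\partial)\imath_\partial=\imath_\partial(d+D_\partial)$. -/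

import Mathlib

open scoped TensorProduct DirectSum

noncomputable section

namespace LInfty

/-! ### Graded vector spaces, parity and degrees of maps -/

section Graded

variable {K : Type*} [Field K] {V : Type*} [AddCommGroup V] [Module K V]

/-- `f` is homogeneous of degree `n`: `f (M^i) ⊆ N^(i+n)` for all `i`. -/
def HasDegree {M N : Type*} [AddCommMonoid M] [Module K M] [AddCommMonoid N] [Module K N]
    (𝓜 : ℤ → Submodule K M) (𝓝 : ℤ → Submodule K N) (n : ℤ) (f : M →ₗ[K] N) : Prop :=
  ∀ i : ℤ, ∀ x ∈ 𝓜 i, f x ∈ 𝓝 (i + n)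

variable (𝓥 : ℤ → Submodule K V) [DirectSum.Decomposition 𝓥]

/-- The projection of a `ℤ`-graded vector space onto its even part (`e = 0`) or its odd part
(`e = 1`). -/
def parityProj (e : ZMod 2) : V →ₗ[K] V :=
  DirectSum.toModule K ℤ V (fun i => if (i : ZMod 2) = e then (𝓥 i).subtype else 0) ∘ₗ
    (DirectSum.decomposeLinearEquiv 𝓥).toLinearMap

/-- The sign operator `v ↦ (-1)^(deg v) v`. -/
def signOp : V →ₗ[K] V := parityProj 𝓥 0 - parityProj 𝓥 1

theorem parityProj_of_mem (e : ZMod 2) {i : ℤ} {v : V} (hv : v ∈ 𝓥 i) :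
    parityProj 𝓥 e v = if (i : ZMod 2) = e then v else 0 := by
  simp only [parityProj, LinearMap.comp_apply, LinearEquiv.coe_coe,
    DirectSum.decomposeLinearEquiv_apply]
  rw [DirectSum.decompose_of_mem 𝓥 hv]
  erw [DirectSum.toModule_lof]
  split_ifs <;> simp

theorem signOp_of_mem {i : ℤ} {v : V} (hv : v ∈ 𝓥 i) :
    signOp 𝓥 v = (i.negOnePow : ℤ) • v := by
  rw [signOp, LinearMap.sub_apply, parityProj_of_mem 𝓥 0 hv, parityProj_of_mem 𝓥 1 hv]
  rcases Int.even_or_odd i with h | h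
  · have h0 : (i : ZMod 2) = 0 := (ZMod.intCast_zmod_eq_zero_iff_dvd i 2).2 h.two_dvd
    simp [h0, Int.negOnePow_even i h]
  · have h1 : (i : ZMod 2) = 1 := by
      obtain ⟨m, rfl⟩ := h
      have h2 : (2 : ZMod 2) = 0 := rfl
      simp [h2]
    simp [h1, Int.negOnePow_odd i h]

theorem linearMap_ext_homogeneous {N : Type*} [AddCommGroup N] [Module K N]
    {f g : V →ₗ[K] N} (h : ∀ i, ∀ v ∈ 𝓥 i, f v = g v) : f = g := by
  classical
  ext v
  rw [← DirectSum.sum_support_decompose 𝓥 v, map_sum, map_sum]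
  exact Finset.sum_congr rfl fun i _ => h i _ (SetLike.coe_mem _)

theorem parityProj_comp (e e' : ZMod 2) :
    parityProj 𝓥 e ∘ₗ parityProj 𝓥 e' = if e = e' then parityProj 𝓥 e' else 0 := by
  refine linearMap_ext_homogeneous 𝓥 fun i v hv => ?_
  rw [LinearMap.comp_apply, parityProj_of_mem 𝓥 e' hv]
  by_cases h' : (i : ZMod 2) = e' <;> by_cases h : e = e' <;>
    simp_all [parityProj_of_mem 𝓥 _ hv, eq_comm]

theorem parityProj_zero_add_one : parityProj 𝓥 0 + parityProj 𝓥 1 = LinearMap.id := by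
  refine linearMap_ext_homogeneous 𝓥 fun i v hv => ?_
  rw [LinearMap.add_apply, parityProj_of_mem 𝓥 0 hv, parityProj_of_mem 𝓥 1 hv]
  rcases Int.even_or_odd i with h | h
  · have h0 : (i : ZMod 2) = 0 := (ZMod.intCast_zmod_eq_zero_iff_dvd i 2).2 h.two_dvd
    simp [h0]
  · have h1 : (i : ZMod 2) = 1 := by
      obtain ⟨m, rfl⟩ := h
      have h2 : (2 : ZMod 2) = 0 := rfl
      simp [h2]
    simp [h1]

end Graded

/-! ### The Koszul action of the symmetric group on tensor powers -/

section Koszul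

variable {K : Type*} [Field K] {V : Type*} [AddCommGroup V] [Module K V]

/-- The Koszul sign of moving the `i`-th factor (of parity `a i`) to the position `σ i`: a factor
`-1` for every pair of odd entries whose order is reversed by `σ`. -/
def koszulSign {n : ℕ} (σ : Equiv.Perm (Fin n)) (a : Fin n → ZMod 2) : ℤ :=
  ∏ p : Fin n × Fin n with p.1 < p.2,
    if σ p.2 < σ p.1 ∧ a p.1 = 1 ∧ a p.2 = 1 then -1 else 1

theorem prod_lt_perm {n : ℕ} (g : Fin n → Fin n → ℤ) (hg : ∀ i j, g i j = g j i)
    (τ : Equiv.Perm (Fin n)) :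
    (∏ p : Fin n × Fin n with p.1 < p.2, g (τ p.1) (τ p.2)) =
      ∏ p : Fin n × Fin n with p.1 < p.2, g p.1 p.2 := by
  have key : ∀ (ρ : Equiv.Perm (Fin n)) (p : Fin n × Fin n), p.1 < p.2 →
      (if ρ p.1 < ρ p.2 then (ρ p.1, ρ p.2) else (ρ p.2, ρ p.1)).1 <
      (if ρ p.1 < ρ p.2 then (ρ p.1, ρ p.2) else (ρ p.2, ρ p.1)).2 := by
    intro ρ p hp
    split_ifs with h
    · exact h
    · exact lt_of_le_of_ne (not_lt.1 h) fun e => hp.ne' (ρ.injective e)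
  refine Finset.prod_bij'
    (fun p _ => if τ p.1 < τ p.2 then (τ p.1, τ p.2) else (τ p.2, τ p.1))
    (fun p _ => if τ.symm p.1 < τ.symm p.2 then (τ.symm p.1, τ.symm p.2)
      else (τ.symm p.2, τ.symm p.1)) ?_ ?_ ?_ ?_ ?_
  · intro p hp
    simpa using key τ p (by simpa using hp)
  · intro p hp
    simpa using key τ.symm p (by simpa using hp)
  · rintro ⟨i, j⟩ hp
    have hp' : i < j := by simpa using hp
    by_cases h : τ i < τ j
    · simp [h, hp']
    · simp [h, hp'.not_gt]
  · rintro ⟨i, j⟩ hp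
    have hp' : i < j := by simpa using hp
    by_cases h : τ.symm i < τ.symm j
    · simp [h, hp']
    · simp [h, hp'.not_gt]
  · rintro ⟨i, j⟩ hp
    by_cases h : τ i < τ j
    · simp [h]
    · simp [h, hg (τ i) (τ j)]

theorem koszulSign_mul {n : ℕ} (σ τ : Equiv.Perm (Fin n)) (a : Fin n → ZMod 2) :
    koszulSign (σ * τ) a = koszulSign σ (a ∘ τ.symm) * koszulSign τ a := by
  have h1 : koszulSign σ (a ∘ τ.symm) =
      ∏ p : Fin n × Fin n with p.1 < p.2,
        if ((p.1 < p.2) ↔ (σ p.2 < σ p.1)) ∧ a (τ.symm p.1) = 1 ∧ a (τ.symm p.2) = 1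
        then -1 else 1 := by
    refine Finset.prod_congr rfl fun p hp => ?_
    have hp' : p.1 < p.2 := by simpa using hp
    simp [hp']
  have h2 := prod_lt_perm (fun i j : Fin n =>
    if i = j then (1 : ℤ) else
    if ((i < j) ↔ (σ j < σ i)) ∧ a (τ.symm i) = 1 ∧ a (τ.symm j) = 1 then -1 else 1) (by
      intro i j
      by_cases hij : i = j
      · simp [hij]
      · have hji : ¬ j = i := fun h => hij h.symm
        have hs : σ i ≠ σ j := fun h => hij (σ.injective h)
        have e : ((i < j) ↔ (σ j < σ i)) ↔ ((j < i) ↔ (σ i < σ j)) := by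
          rcases lt_or_gt_of_ne hij with h | h <;> rcases lt_or_gt_of_ne hs with h' | h' <;>
            simp [h, h', h.not_gt, h'.not_gt]
        simp only [hij, hji, if_false, e]
        congr 1
        simp only [eq_iff_iff]
        tauto) τ
  have h3 : koszulSign σ (a ∘ τ.symm) =
      ∏ p : Fin n × Fin n with p.1 < p.2,
        if ((τ p.1 < τ p.2) ↔ (σ (τ p.2) < σ (τ p.1))) ∧ a p.1 = 1 ∧ a p.2 = 1
        then -1 else 1 := by
    rw [h1]
    refine Eq.trans ?_ (h2.symm.trans ?_)
    · refine Finset.prod_congr rfl fun p hp => ?_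
      have hp' : p.1 ≠ p.2 := by
        have : p.1 < p.2 := by simpa using hp
        exact this.ne
      simp [hp']
    · refine Finset.prod_congr rfl fun p hp => ?_
      have hp' : p.1 ≠ p.2 := by
        have : p.1 < p.2 := by simpa using hp
        exact this.ne
      simp [hp']
  rw [h3, koszulSign, koszulSign, ← Finset.prod_mul_distrib]
  refine Finset.prod_congr rfl fun p hp => ?_
  have hp' : p.1 < p.2 := by simpa using hp
  have hτ : τ p.1 ≠ τ p.2 := fun h => hp'.ne (τ.injective h)
  have hσ : σ (τ p.1) ≠ σ (τ p.2) := fun h => hτ (σ.injective h)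
  by_cases ha : a p.1 = 1 ∧ a p.2 = 1
  · rcases lt_or_gt_of_ne hτ with h | h <;> rcases lt_or_gt_of_ne hσ with h' | h' <;>
      simp [ha, h, h', h.not_gt, h'.not_gt]
  · simp [ha]

theorem koszulSign_one {n : ℕ} (a : Fin n → ZMod 2) : koszulSign 1 a = 1 := by
  refine Finset.prod_eq_one fun p hp => ?_
  have hp' : p.1 < p.2 := by simpa using hp
  simp [hp'.not_gt]

variable (𝓥 : ℤ → Submodule K V) [DirectSum.Decomposition 𝓥]

/-- The operator `σ_tw` on `V^{⊗n}`:
`σ_tw (v₁ ⊗ ⋯ ⊗ vₙ) = ± v_{σ⁻¹(1)} ⊗ ⋯ ⊗ v_{σ⁻¹(n)}` with the Koszul sign, written as a sum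
over the possible parities of the factors (see `koszulAction_tprod`). -/
def koszulAction {n : ℕ} (σ : Equiv.Perm (Fin n)) : (⨂[K]^n V) →ₗ[K] (⨂[K]^n V) :=
  ∑ a : Fin n → ZMod 2, (koszulSign σ a : K) •
    ((PiTensorProduct.reindex K (fun _ => V) σ).toLinearMap ∘ₗ
      PiTensorProduct.map fun i => parityProj 𝓥 (a i))

theorem koszulAction_apply_tprod {n : ℕ} (σ : Equiv.Perm (Fin n)) (v : Fin n → V) :
    koszulAction 𝓥 σ (PiTensorProduct.tprod K v) =
      ∑ a : Fin n → ZMod 2, (koszulSign σ a : K) •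
        PiTensorProduct.tprod K (fun i => parityProj 𝓥 (a (σ.symm i)) (v (σ.symm i))) := by
  rw [koszulAction, LinearMap.sum_apply]
  refine Finset.sum_congr rfl fun a _ => ?_
  rw [LinearMap.smul_apply, LinearMap.comp_apply, PiTensorProduct.map_tprod,
    LinearEquiv.coe_coe]
  erw [PiTensorProduct.reindex_tprod]

/-- On tensors whose factors have a definite parity. -/
theorem koszulAction_tprod_parity {n : ℕ} (σ : Equiv.Perm (Fin n)) (a : Fin n → ZMod 2)
    (v : Fin n → V) (hv : ∀ i e, parityProj 𝓥 e (v i) = if a i = e then v i else 0) :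
    koszulAction 𝓥 σ (PiTensorProduct.tprod K v) =
      (koszulSign σ a : K) • PiTensorProduct.tprod K (fun i => v (σ.symm i)) := by
  rw [koszulAction_apply_tprod, Finset.sum_eq_single a]
  · congr 2
    funext i
    rw [hv, if_pos rfl]
  · intro b _ hb
    obtain ⟨i, hi⟩ := Function.ne_iff.1 hb
    rw [MultilinearMap.map_coord_zero _ (σ i)
      (by rw [Equiv.symm_apply_apply, hv, if_neg (Ne.symm hi)]), smul_zero]
  · simp

/-- On homogeneous tensors, `σ_tw` is given by the usual formula. -/
theorem koszulAction_tprod {n : ℕ} (σ : Equiv.Perm (Fin n)) (a : Fin n → ℤ) (v : Fin n → V)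
    (hv : ∀ i, v i ∈ 𝓥 (a i)) :
    koszulAction 𝓥 σ (PiTensorProduct.tprod K v) =
      (koszulSign σ (fun i => (a i : ZMod 2)) : K) •
        PiTensorProduct.tprod K (fun i => v (σ.symm i)) :=
  koszulAction_tprod_parity 𝓥 σ _ v fun i e => parityProj_of_mem 𝓥 e (hv i)

theorem tprod_eq_sum_parity {n : ℕ} (v : Fin n → V) :
    PiTensorProduct.tprod K v =
      ∑ a : Fin n → ZMod 2, PiTensorProduct.tprod K fun i => parityProj 𝓥 (a i) (v i) := by
  have h : ∀ i, v i = ∑ e : ZMod 2, parityProj 𝓥 e (v i) := fun i => by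
    have := LinearMap.congr_fun (parityProj_zero_add_one 𝓥) (v i)
    exact this.symm.trans (Fin.sum_univ_two fun e : ZMod 2 => parityProj 𝓥 e (v i)).symm
  have h' := (PiTensorProduct.tprod K).map_sum (fun i (e : ZMod 2) => parityProj 𝓥 e (v i))
  simp only [← h] at h'
  exact h'

theorem parityProj_parityProj (e e' : ZMod 2) (v : V) :
    parityProj 𝓥 e (parityProj 𝓥 e' v) = if e' = e then parityProj 𝓥 e' v else 0 := by
  have := LinearMap.congr_fun (parityProj_comp 𝓥 e e') v
  rw [LinearMap.comp_apply] at this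
  rw [this]
  by_cases h : e' = e
  · rw [if_pos h, if_pos h.symm]
  · rw [if_neg h, if_neg (Ne.symm h), LinearMap.zero_apply]

/-- Linear maps on `V^{⊗n}` agree if they agree on tensors whose factors have a parity. -/
theorem ext_parity {n : ℕ} {M : Type*} [AddCommGroup M] [Module K M]
    {f g : (⨂[K]^n V) →ₗ[K] M}
    (h : ∀ (a : Fin n → ZMod 2) (v : Fin n → V),
      (∀ i e, parityProj 𝓥 e (v i) = if a i = e then v i else 0) →
      f (PiTensorProduct.tprod K v) = g (PiTensorProduct.tprod K v)) : f = g := by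
  refine PiTensorProduct.ext (MultilinearMap.ext fun v => ?_)
  rw [LinearMap.compMultilinearMap_apply, LinearMap.compMultilinearMap_apply,
    tprod_eq_sum_parity 𝓥, map_sum, map_sum]
  exact Finset.sum_congr rfl fun a _ => h a _ fun i e => parityProj_parityProj 𝓥 _ _ _

theorem koszulAction_mul {n : ℕ} (σ τ : Equiv.Perm (Fin n)) :
    koszulAction 𝓥 (σ * τ) = koszulAction 𝓥 σ ∘ₗ koszulAction 𝓥 τ := by
  refine ext_parity 𝓥 fun a v hv => ?_
  rw [LinearMap.comp_apply, koszulAction_tprod_parity 𝓥 _ a v hv,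
    koszulAction_tprod_parity 𝓥 _ a v hv, map_smul,
    koszulAction_tprod_parity 𝓥 σ (a ∘ τ.symm) _ (fun i e => hv _ e), smul_smul,
    koszulSign_mul, Int.cast_mul, mul_comm]
  rfl

theorem koszulAction_one {n : ℕ} :
    koszulAction 𝓥 (1 : Equiv.Perm (Fin n)) = LinearMap.id := by
  refine ext_parity 𝓥 fun a v hv => ?_
  rw [koszulAction_tprod_parity 𝓥 _ a v hv, koszulSign_one, Int.cast_one, one_smul]
  rfl

/-- The invariant tensors `⨀ⁿ V = (V^{⊗n})^{Σₙ}`. -/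
def symPower (n : ℕ) : Submodule K (⨂[K]^n V) :=
  ⨅ σ : Equiv.Perm (Fin n), LinearMap.eqLocus (koszulAction 𝓥 σ) LinearMap.id

theorem mem_symPower {n : ℕ} {x : ⨂[K]^n V} :
    x ∈ symPower 𝓥 n ↔ ∀ σ : Equiv.Perm (Fin n), koszulAction 𝓥 σ x = x := by
  simp [symPower, Submodule.mem_iInf, LinearMap.mem_eqLocus]

/-- The symmetrization `(1/n!) ∑_σ σ_tw`. -/
def symmetrizer (n : ℕ) : (⨂[K]^n V) →ₗ[K] (⨂[K]^n V) :=
  (n.factorial : K)⁻¹ • ∑ σ : Equiv.Perm (Fin n), koszulAction 𝓥 σ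

theorem symmetrizer_mem {n : ℕ} (x : ⨂[K]^n V) : symmetrizer 𝓥 n x ∈ symPower 𝓥 n := by
  rw [mem_symPower]
  intro σ
  simp only [symmetrizer, LinearMap.smul_apply, LinearMap.sum_apply, map_smul, map_sum]
  congr 1
  refine Fintype.sum_equiv (Equiv.mulLeft σ) _ _ fun τ => ?_
  simp [koszulAction_mul]

end Koszul

/-! ### The reduced tensor coalgebra -/

section TensorCoalgebra

variable (K : Type*) [Field K] (V : Type*) [AddCommGroup V] [Module K V]

/-- The reduced tensor space `T̄(V) = ⨁_{n ≥ 1} V^{⊗n}`; the summand of index `n : ℕ` is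
`V^{⊗(n+1)}`. -/
abbrev TBar : Type _ := ⨁ n : ℕ, ⨂[K]^(n + 1) V

variable {K V} {W : Type*} [AddCommGroup W] [Module K W]

/-- Splitting a tensor of length `N = p + q` after its first `p` factors:
`x₁ ⊗ ⋯ ⊗ x_N ↦ (x₁ ⊗ ⋯ ⊗ x_p) ⊗ (x_{p+1} ⊗ ⋯ ⊗ x_N)`. -/
def splitAt {N p q : ℕ} (h : N = p + q) : (⨂[K]^N V) →ₗ[K] (⨂[K]^p V) ⊗[K] (⨂[K]^q V) :=
  (TensorPower.mulEquiv (R := K) (M := V) (n := p) (m := q)).symm.toLinearMap ∘ₗ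
    (TensorPower.cast K V h).toLinearMap

theorem splitAt_tprod {N p q : ℕ} (h : N = p + q) (v : Fin N → V) :
    splitAt h (PiTensorProduct.tprod K v) =
      PiTensorProduct.tprod K (fun i : Fin p => v ((Fin.castAdd q i).cast h.symm)) ⊗ₜ[K]
        PiTensorProduct.tprod K (fun j : Fin q => v ((Fin.natAdd p j).cast h.symm)) := by
  rw [splitAt, LinearMap.comp_apply, LinearEquiv.coe_coe, LinearEquiv.coe_coe,
    LinearEquiv.symm_apply_eq, ← TensorPower.gMul_def, TensorPower.tprod_mul_tprod,
    TensorPower.cast_tprod]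
  congr 1
  funext i
  refine Fin.addCases (fun i => ?_) (fun i => ?_) i <;> simp

/-- The deconcatenation coproduct
`𝔞(x₁ ⊗ ⋯ ⊗ xₙ) = ∑_{i=1}^{n-1} (x₁ ⊗ ⋯ ⊗ xᵢ) ⊗ (xᵢ₊₁ ⊗ ⋯ ⊗ xₙ)` on `T̄(V)`. -/
def deconcat : TBar K V →ₗ[K] TBar K V ⊗[K] TBar K V :=
  DirectSum.toModule K ℕ _ fun n => ∑ i : Fin n,
    TensorProduct.map (DirectSum.lof K ℕ (fun m => ⨂[K]^(m + 1) V) i)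
      (DirectSum.lof K ℕ (fun m => ⨂[K]^(m + 1) V) (n - (i + 1))) ∘ₗ
    splitAt (show n + 1 = (i + 1) + (n - (i + 1) + 1) by omega)

/-- `T(f) = ∑ₙ f^{⊗n}` for a linear map `f` (of degree `0`). -/
def tMap (f : V →ₗ[K] W) : TBar K V →ₗ[K] TBar K W :=
  DirectSum.lmap fun _ => PiTensorProduct.map fun _ => f

/-- The projection `p : T̄(V) → V`. -/
def tProj : TBar K V →ₗ[K] V :=
  (PiTensorProduct.subsingletonEquiv (R := K) (s := fun _ : Fin 1 => V) 0).toLinearMap ∘ₗ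
    DirectSum.component K ℕ (fun n => ⨂[K]^(n + 1) V) 0

/-- The inclusion `V = V^{⊗1} ⊆ T̄(V)`. -/
def tIncl : V →ₗ[K] TBar K V :=
  DirectSum.lof K ℕ (fun n => ⨂[K]^(n + 1) V) 0 ∘ₗ
    (PiTensorProduct.subsingletonEquiv (R := K) (s := fun _ : Fin 1 => V)
      0).symm.toLinearMap

/-- The restriction `d₁ = Q|_V : V → V` of a coderivation `Q` of `T̄(V)`. -/
def linearPart (Q : TBar K V →ₗ[K] TBar K V) : V →ₗ[K] V := tProj ∘ₗ Q ∘ₗ tIncl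

variable (𝓥 : ℤ → Submodule K V)

/-- The grading of `T̄(V)` by total degree. -/
def tGrading (k : ℤ) : Submodule K (TBar K V) :=
  Submodule.span K {x | ∃ (n : ℕ) (a : Fin (n + 1) → ℤ) (v : Fin (n + 1) → V),
    (∀ i, v i ∈ 𝓥 (a i)) ∧ ∑ i, a i = k ∧
      x = DirectSum.lof K ℕ (fun n => ⨂[K]^(n + 1) V) n (PiTensorProduct.tprod K v)}

variable [DirectSum.Decomposition 𝓥]

/-- The sign operator `x ↦ (-1)^(deg x) x` of `T̄(V)` (see `tSign_of_mem`). -/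
def tSign : TBar K V →ₗ[K] TBar K V := tMap (signOp 𝓥)

theorem tSign_of_mem {k : ℤ} {x : TBar K V} (hx : x ∈ tGrading 𝓥 k) :
    tSign 𝓥 x = ((k.negOnePow : ℤ) : K) • x := by
  induction hx using Submodule.span_induction with
  | zero => simp
  | add x y _ _ hx hy => rw [map_add, hx, hy, smul_add]
  | smul c x _ hx => rw [map_smul, hx, smul_comm]
  | mem x hx =>
    obtain ⟨n, a, v, hv, rfl, rfl⟩ := hx
    have h : ∀ i, signOp 𝓥 (v i) = (((a i).negOnePow : ℤ) : K) • v i := fun i => by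
      rw [signOp_of_mem 𝓥 (hv i), Int.cast_smul_eq_zsmul]
    have e : ∏ i, (((a i).negOnePow : ℤ) : K) = (((∑ i, a i).negOnePow : ℤ) : K) := by
      have : ∀ s : Finset (Fin (n + 1)),
          ∏ i ∈ s, (((a i).negOnePow : ℤ) : K) = (((∑ i ∈ s, a i).negOnePow : ℤ) : K) := by
        intro s
        induction s using Finset.cons_induction with
        | empty => simp
        | cons i s hi ih =>
          rw [Finset.prod_cons, Finset.sum_cons, ih, Int.negOnePow_add]
          push_cast
          rfl
      exact this _
    rw [tSign, tMap, DirectSum.lmap_lof, PiTensorProduct.map_tprod]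
    simp only [h]
    rw [MultilinearMap.map_smul_univ, e, map_smul]

/-- `∑ₙ ∑_{i=1}^n f^{⊗(i-1)} ⊗ g ⊗ Id^{⊗(n-i)}` on `T̄(V)`, where `f` has degree `0` and `g` has
odd degree, with the Koszul sign: on homogeneous elements,
`x₁ ⊗ ⋯ ⊗ xₙ ↦ ∑ᵢ (-1)^(deg x₁ + ⋯ + deg xᵢ₋₁) f x₁ ⊗ ⋯ ⊗ f xᵢ₋₁ ⊗ g xᵢ ⊗ xᵢ₊₁ ⊗ ⋯ ⊗ xₙ`. -/
def tInsert (f g : V →ₗ[K] V) : TBar K V →ₗ[K] TBar K V :=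
  DirectSum.lmap fun n => ∑ i : Fin (n + 1), PiTensorProduct.map fun j =>
    if j < i then f ∘ₗ signOp 𝓥 else if j = i then g else LinearMap.id

/-- The natural differential on the tensor powers of a complex `(V, d)`. -/
def tDiff (d : V →ₗ[K] V) : TBar K V →ₗ[K] TBar K V := tInsert 𝓥 LinearMap.id d

/-- The homotopy `Tk = ∑ₙ Tⁿk`, `Tⁿk = ∑_{i=1}^n (ιπ)^{⊗(i-1)} ⊗ k ⊗ Id^{⊗(n-i)}`. -/
def tHomotopy (ι : W →ₗ[K] V) (π : V →ₗ[K] W) (k : V →ₗ[K] V) : TBar K V →ₗ[K] TBar K V :=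
  tInsert 𝓥 (ι ∘ₗ π) k

end TensorCoalgebra

/-! ### The reduced symmetric coalgebra -/

section SymmetricCoalgebra

variable {K : Type*} [Field K] {V : Type*} [AddCommGroup V] [Module K V]
variable (𝓥 : ℤ → Submodule K V) [DirectSum.Decomposition 𝓥]

/-- The reduced symmetric coalgebra `S̄(V) = ⨁_{n ≥ 1} ⨀ⁿ V ⊆ T̄(V)`. -/
def SBar : Submodule K (TBar K V) :=
  ⨅ n : ℕ, (symPower 𝓥 (n + 1)).comap (DirectSum.component K ℕ (fun n => ⨂[K]^(n + 1) V) n)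

theorem mem_SBar {x : TBar K V} : x ∈ SBar 𝓥 ↔ ∀ n, x n ∈ symPower 𝓥 (n + 1) := by
  simp [SBar, Submodule.mem_iInf, DirectSum.apply_eq_component K]

/-- The grading of `S̄(V)` by total degree. -/
def sGrading (k : ℤ) : Submodule K (SBar 𝓥) := (tGrading 𝓥 k).comap (SBar 𝓥).subtype

theorem signOp_parityProj (e : ZMod 2) (v : V) :
    parityProj 𝓥 e (signOp 𝓥 v) = signOp 𝓥 (parityProj 𝓥 e v) := by
  simp only [signOp, LinearMap.sub_apply, map_sub, parityProj_parityProj]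
  congr 1 <;> (split_ifs <;> simp_all)

theorem koszulAction_map_signOp {n : ℕ} (σ : Equiv.Perm (Fin n)) (x : ⨂[K]^n V) :
    koszulAction 𝓥 σ (PiTensorProduct.map (fun _ => signOp 𝓥) x) =
      PiTensorProduct.map (fun _ => signOp 𝓥) (koszulAction 𝓥 σ x) := by
  refine LinearMap.congr_fun (f := koszulAction 𝓥 σ ∘ₗ PiTensorProduct.map fun _ => signOp 𝓥)
    (g := (PiTensorProduct.map fun _ => signOp 𝓥) ∘ₗ koszulAction 𝓥 σ)
    (ext_parity 𝓥 fun a v hv => ?_) x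
  rw [LinearMap.comp_apply, LinearMap.comp_apply, koszulAction_tprod_parity 𝓥 σ a v hv,
    map_smul, PiTensorProduct.map_tprod, PiTensorProduct.map_tprod,
    koszulAction_tprod_parity 𝓥 σ a _ fun i e => ?_]
  rw [signOp_parityProj, hv]
  split_ifs <;> simp

theorem tSign_mem_SBar (x : TBar K V) (hx : x ∈ SBar 𝓥) : tSign 𝓥 x ∈ SBar 𝓥 := by
  rw [mem_SBar] at hx ⊢
  intro n
  rw [mem_symPower]
  intro σ
  have h : tSign 𝓥 x n = PiTensorProduct.map (fun _ => signOp 𝓥) (x n) :=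
    DirectSum.lmap_apply _ _ _
  rw [h, koszulAction_map_signOp, (mem_symPower 𝓥).1 (hx n) σ]

/-- The sign operator `x ↦ (-1)^(deg x) x` of `S̄(V)`. -/
def sSign : SBar 𝓥 →ₗ[K] SBar 𝓥 := (tSign 𝓥).restrict (tSign_mem_SBar 𝓥)

/-- The projection `T̄(V) → S̄(V)` given by symmetrization. -/
def sProj : TBar K V →ₗ[K] SBar 𝓥 :=
  (DirectSum.lmap fun n => symmetrizer 𝓥 (n + 1)).codRestrict (SBar 𝓥) fun x => by
    rw [mem_SBar]
    intro n
    rw [DirectSum.lmap_apply]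
    exact symmetrizer_mem 𝓥 _

/-- The coproduct of `S̄(V)`: the restriction of the deconcatenation coproduct of `T̄(V)`, as a map
into `S̄(V) ⊗ S̄(V) ⊆ T̄(V) ⊗ T̄(V)`; see `subtype_comp_sCoproduct`. -/
def sCoproduct : SBar 𝓥 →ₗ[K] SBar 𝓥 ⊗[K] SBar 𝓥 :=
  TensorProduct.map (sProj 𝓥) (sProj 𝓥) ∘ₗ deconcat ∘ₗ (SBar 𝓥).subtype

/-- The permutation of `{1, …, p + q}` that acts by `σ` on the first `p` and by `τ` on the last
`q` elements. -/
def blockPerm {p q : ℕ} (σ : Equiv.Perm (Fin p)) (τ : Equiv.Perm (Fin q)) :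
    Equiv.Perm (Fin (p + q)) :=
  finSumFinEquiv.permCongr (Equiv.sumCongr σ τ)

theorem blockPerm_castAdd {p q : ℕ} (σ : Equiv.Perm (Fin p)) (τ : Equiv.Perm (Fin q))
    (i : Fin p) : blockPerm σ τ (Fin.castAdd q i) = Fin.castAdd q (σ i) := by
  simp [blockPerm, Equiv.permCongr_apply]

theorem blockPerm_natAdd {p q : ℕ} (σ : Equiv.Perm (Fin p)) (τ : Equiv.Perm (Fin q))
    (i : Fin q) : blockPerm σ τ (Fin.natAdd p i) = Fin.natAdd p (τ i) := by
  simp [blockPerm, Equiv.permCongr_apply]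

theorem koszulSign_eq {n : ℕ} (σ : Equiv.Perm (Fin n)) (a : Fin n → ZMod 2) :
    koszulSign σ a = ∏ i, ∏ j, if i < j then
      (if σ j < σ i ∧ a i = 1 ∧ a j = 1 then -1 else 1) else 1 := by
  rw [koszulSign, Finset.prod_filter, Fintype.prod_prod_type]

theorem koszulSign_blockPerm {p q : ℕ} (σ : Equiv.Perm (Fin p)) (τ : Equiv.Perm (Fin q))
    (a : Fin (p + q) → ZMod 2) :
    koszulSign (blockPerm σ τ) a =
      koszulSign σ (fun i => a (Fin.castAdd q i)) *
        koszulSign τ (fun i => a (Fin.natAdd p i)) := by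
  have h1 : ∀ (i : Fin p) (j : Fin q), ¬ Fin.natAdd p j < Fin.castAdd q i := fun i j => by
    simp only [Fin.lt_def, Fin.val_natAdd, Fin.val_castAdd]; omega
  have h2 : ∀ i j : Fin p, Fin.castAdd q i < Fin.castAdd q j ↔ i < j := fun i j => by
    simp only [Fin.lt_def, Fin.val_castAdd]
  have h3 : ∀ i j : Fin q, Fin.natAdd p i < Fin.natAdd p j ↔ i < j := fun i j => by
    simp only [Fin.lt_def, Fin.val_natAdd]; omega
  simp only [koszulSign_eq, Fin.prod_univ_add, blockPerm_castAdd, blockPerm_natAdd, h1, h2, h3]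
  simp

theorem map_koszulAction_splitAt {N p q : ℕ} (h : N = p + q) (σ : Equiv.Perm (Fin p))
    (τ : Equiv.Perm (Fin q)) {x : ⨂[K]^N V} (hx : x ∈ symPower 𝓥 N) :
    TensorProduct.map (koszulAction 𝓥 σ) (koszulAction 𝓥 τ) (splitAt h x) = splitAt h x := by
  subst h
  conv_rhs => rw [← (mem_symPower 𝓥).1 hx (blockPerm σ τ)]
  refine LinearMap.congr_fun
    (f := TensorProduct.map (koszulAction 𝓥 σ) (koszulAction 𝓥 τ) ∘ₗ splitAt rfl)
    (g := splitAt rfl ∘ₗ koszulAction 𝓥 (blockPerm σ τ)) (ext_parity 𝓥 fun a v hv => ?_) x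
  have e1 : ∀ i, (blockPerm σ τ).symm (Fin.castAdd q i) = Fin.castAdd q (σ.symm i) := fun i => by
    rw [Equiv.symm_apply_eq, blockPerm_castAdd, Equiv.apply_symm_apply]
  have e2 : ∀ i, (blockPerm σ τ).symm (Fin.natAdd p i) = Fin.natAdd p (τ.symm i) := fun i => by
    rw [Equiv.symm_apply_eq, blockPerm_natAdd, Equiv.apply_symm_apply]
  rw [LinearMap.comp_apply, LinearMap.comp_apply, splitAt_tprod, TensorProduct.map_tmul,
    koszulAction_tprod_parity 𝓥 _ a v hv, map_smul, splitAt_tprod]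
  simp only [Fin.cast_eq_self, e1, e2]
  rw [koszulAction_tprod_parity 𝓥 σ (fun i => a (Fin.castAdd q i)) _ fun i e => hv _ e,
    koszulAction_tprod_parity 𝓥 τ (fun i => a (Fin.natAdd p i)) _ fun i e => hv _ e,
    koszulSign_blockPerm, TensorProduct.smul_tmul_smul, Int.cast_mul]

theorem map_symmetrizer_splitAt [CharZero K] {N p q : ℕ} (h : N = p + q) {x : ⨂[K]^N V}
    (hx : x ∈ symPower 𝓥 N) :
    TensorProduct.map (symmetrizer 𝓥 p) (symmetrizer 𝓥 q) (splitAt h x) = splitAt h x := by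
  have hp : (p.factorial : K) ≠ 0 := Nat.cast_ne_zero.2 p.factorial_ne_zero
  have hq : (q.factorial : K) ≠ 0 := Nat.cast_ne_zero.2 q.factorial_ne_zero
  have e : TensorProduct.map (symmetrizer 𝓥 p) (symmetrizer 𝓥 q) =
      ((p.factorial : K)⁻¹ * (q.factorial : K)⁻¹) •
        ∑ σ : Equiv.Perm (Fin p), ∑ τ : Equiv.Perm (Fin q),
          TensorProduct.map (koszulAction 𝓥 σ) (koszulAction 𝓥 τ) := by
    refine TensorProduct.ext' fun y z => ?_
    simp only [symmetrizer, TensorProduct.map_tmul, LinearMap.smul_apply, LinearMap.sum_apply,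
      TensorProduct.smul_tmul_smul, TensorProduct.sum_tmul, TensorProduct.tmul_sum]
    rw [Finset.sum_comm]
  rw [e, LinearMap.smul_apply, LinearMap.sum_apply]
  simp only [LinearMap.sum_apply, map_koszulAction_splitAt 𝓥 h _ _ hx, Finset.sum_const,
    Finset.card_univ, Fintype.card_perm, Fintype.card_fin, ← Nat.cast_smul_eq_nsmul K, smul_smul]
  rw [show (p.factorial : K)⁻¹ * (q.factorial : K)⁻¹ * (p.factorial * q.factorial) = 1 by
    field_simp, one_smul]

/-- `S̄(V)` is a subcoalgebra of `T̄(V)`, with coproduct `sCoproduct`. -/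
theorem subtype_comp_sCoproduct [CharZero K] :
    TensorProduct.map (SBar 𝓥).subtype (SBar 𝓥).subtype ∘ₗ sCoproduct 𝓥 =
      deconcat ∘ₗ (SBar 𝓥).subtype := by
  classical
  have e : (SBar 𝓥).subtype ∘ₗ sProj 𝓥 = DirectSum.lmap fun n => symmetrizer 𝓥 (n + 1) :=
    LinearMap.subtype_comp_codRestrict _ _ _
  rw [sCoproduct, ← LinearMap.comp_assoc, ← TensorProduct.map_comp, e]
  ext ⟨x, hx⟩
  rw [mem_SBar] at hx
  simp only [LinearMap.comp_apply, Submodule.subtype_apply]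
  rw [← DirectSum.sum_support_of x]
  simp only [map_sum]
  refine Finset.sum_congr rfl fun n _ => ?_
  change TensorProduct.map _ _ (deconcat (DirectSum.lof K ℕ (fun n => ⨂[K]^(n + 1) V) n (x n))) =
    deconcat (DirectSum.lof K ℕ (fun n => ⨂[K]^(n + 1) V) n (x n))
  rw [deconcat, DirectSum.toModule_lof, LinearMap.sum_apply, map_sum]
  refine Finset.sum_congr rfl fun i _ => ?_
  rw [LinearMap.comp_apply]
  conv_rhs => rw [← map_symmetrizer_splitAt 𝓥 _ (hx n)]
  rw [← LinearMap.comp_apply, ← LinearMap.comp_apply (TensorProduct.map _ _)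
    (TensorProduct.map _ _), ← TensorProduct.map_comp, ← TensorProduct.map_comp]
  congr 2 <;> (refine LinearMap.ext fun y => ?_) <;>
    simp only [LinearMap.comp_apply, DirectSum.lmap_lof]

end SymmetricCoalgebra

/-! ### Graded coalgebras, coderivations, contractions -/

section Coalgebra

variable {K : Type*} [Field K] {C D M N : Type*}
  [AddCommMonoid C] [Module K C] [AddCommMonoid D] [Module K D]
  [AddCommGroup M] [Module K M] [AddCommGroup N] [Module K N]

/-- `Q` is a coderivation of degree `+1` of the graded coalgebra `C` with grading `𝓒`, sign operator
`ε x = (-1)^(deg x) x` and coproduct `Δ`: it has degree `+1` and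
`Δ Q = (Q ⊗ Id + Id ⊗ Q) Δ`, where `(Id ⊗ Q)(x ⊗ y) = (-1)^(deg x) x ⊗ Q y`. -/
structure IsCoderivation (𝓒 : ℤ → Submodule K C) (ε : C →ₗ[K] C) (Δ : C →ₗ[K] C ⊗[K] C)
    (Q : C →ₗ[K] C) : Prop where
  degree : HasDegree 𝓒 𝓒 1 Q
  leibniz : Δ ∘ₗ Q =
    (TensorProduct.map Q LinearMap.id + TensorProduct.map ε Q) ∘ₗ Δ

/-- A codifferential: a coderivation of degree `+1` with square zero. -/
structure IsCodifferential (𝓒 : ℤ → Submodule K C) (ε : C →ₗ[K] C) (Δ : C →ₗ[K] C ⊗[K] C)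
    (Q : C →ₗ[K] C) : Prop extends IsCoderivation 𝓒 ε Δ Q where
  sq_zero : Q ∘ₗ Q = 0

/-- Morphisms of graded coalgebras. -/
structure IsCoalgebraHom (𝓒 : ℤ → Submodule K C) (ΔC : C →ₗ[K] C ⊗[K] C)
    (𝓓 : ℤ → Submodule K D) (ΔD : D →ₗ[K] D ⊗[K] D) (F : C →ₗ[K] D) : Prop where
  degree : HasDegree 𝓒 𝓓 0 F
  comul : ΔD ∘ₗ F = TensorProduct.map F F ∘ₗ ΔC

/-- A contraction `(M ⇄ N, h)` of differential graded modules `(M, dM)`, `(N, dN)`. -/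
structure IsContraction (𝓜 : ℤ → Submodule K M) (dM : M →ₗ[K] M)
    (𝓝 : ℤ → Submodule K N) (dN : N →ₗ[K] N)
    (ι : M →ₗ[K] N) (π : N →ₗ[K] M) (h : N →ₗ[K] N) : Prop where
  degree_dM : HasDegree 𝓜 𝓜 1 dM
  dM_sq : dM ∘ₗ dM = 0
  degree_dN : HasDegree 𝓝 𝓝 1 dN
  dN_sq : dN ∘ₗ dN = 0
  degree_ι : HasDegree 𝓜 𝓝 0 ι
  ι_comm : dN ∘ₗ ι = ι ∘ₗ dM
  degree_π : HasDegree 𝓝 𝓜 0 π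
  π_comm : dM ∘ₗ π = π ∘ₗ dN
  degree_h : HasDegree 𝓝 𝓝 (-1) h
  π_ι : π ∘ₗ ι = LinearMap.id
  homotopy : ι ∘ₗ π - LinearMap.id = dN ∘ₗ h + h ∘ₗ dN
  π_h : π ∘ₗ h = 0
  h_ι : h ∘ₗ ι = 0
  h_h : h ∘ₗ h = 0

/-- A coalgebra contraction `(M ⇄ N, h)` of differential graded coalgebras: `ι` and `π` are morphisms
of differential graded coalgebras and `Δ h = (ιπ ⊗ h + h ⊗ Id) Δ` on `N`, where, `h` being odd,
`(ιπ ⊗ h)(x ⊗ y) = (-1)^(deg x) ιπ x ⊗ h y`. -/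
structure IsCoalgebraContraction (𝓜 : ℤ → Submodule K M) (εM : M →ₗ[K] M)
    (ΔM : M →ₗ[K] M ⊗[K] M) (dM : M →ₗ[K] M) (𝓝 : ℤ → Submodule K N) (εN : N →ₗ[K] N)
    (ΔN : N →ₗ[K] N ⊗[K] N) (dN : N →ₗ[K] N)
    (ι : M →ₗ[K] N) (π : N →ₗ[K] M) (h : N →ₗ[K] N) : Prop
    extends IsContraction 𝓜 dM 𝓝 dN ι π h where
  codifferential_dM : IsCodifferential 𝓜 εM ΔM dM
  codifferential_dN : IsCodifferential 𝓝 εN ΔN dN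
  hom_ι : IsCoalgebraHom 𝓜 ΔM 𝓝 ΔN ι
  hom_π : IsCoalgebraHom 𝓝 ΔN 𝓜 ΔM π
  comul_h : ΔN ∘ₗ h =
    (TensorProduct.map (ι ∘ₗ π ∘ₗ εN) h + TensorProduct.map h LinearMap.id) ∘ₗ ΔN

/-- `F = ∑_{n ≥ 0} f n`, a sum with finitely many nonzero terms at every vector. -/
def IsPointwiseSum (f : ℕ → M →ₗ[K] N) (F : M →ₗ[K] N) : Prop :=
  ∀ x, (Function.support fun n => f n x).Finite ∧ F x = ∑ᶠ n, f n x

end Coalgebra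

end LInfty

open LInfty

namespace LInfty

/-! ### Deconcatenation, the length filtration, and uniqueness of coderivation-like maps. -/

section TensorSplitting

variable {K : Type*} [Field K] {V : Type*} [AddCommGroup V] [Module K V]
  {W : Type*} [AddCommGroup W] [Module K W]

/-! The perturbation is carried out on the whole tensor coalgebra, where `Q ∘ Q` need not vanish;
symmetric tensors enter only at the end.

The kernel of deconcatenation is `V`, and both pieces of a cut tensor are shorter than the tensor.
Induction on length therefore shows that two maps obeying suitable Leibniz rules agree once their
corestrictions to `V` agree (`eq_of_leibniz`). This reduces every identity of the tensor contraction
except `π ι = id`, which is functorial, to the corresponding identity on `V`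
(`isCoalgebraContraction_tMap`). A similar induction shows that the coderivation `δ`, having no
linear part, shortens tensors. Hence `h δ` is locally nilpotent, and the equation `F = ι + h δ F`
has the geometric series as its unique solution.

Uniqueness of solutions is then used twice. Both `Δ F` and `(F ⊗ F) Δ` solve one fixed-point
equation with a locally nilpotent operator, so `F` is a coalgebra morphism without any assumption on
`Q ∘ Q` (`IsCoalgebraContraction.perturbation`). The defect of `F` as a chain map at `x` is fixed by
`h δ`, hence zero, as soon as `Q (Q (F x)) = 0` (`IsContraction.perturbation_comm`).

What remains is that `F x` is symmetric for symmetric `x`. Coalgebra morphisms and odd coderivations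
of tensor coalgebras preserve symmetric tensors: in length two this is graded cocommutativity, and
in greater length symmetry is detected by cutting off the first or the last factor
(`IsCoalgebraHom.mem_SBar`, `IsCoderivation.mem_SBar`). Finally `π F = id` makes `F` injective,
which carries square zero over to `W`. -/

theorem splitAt_map {N p q : ℕ} (h : N = p + q) (u : Fin N → V →ₗ[K] W) (x : ⨂[K]^N V) :
    splitAt h (PiTensorProduct.map u x) =
      TensorProduct.map (PiTensorProduct.map fun i : Fin p => u ((Fin.castAdd q i).cast h.symm))
        (PiTensorProduct.map fun j : Fin q => u ((Fin.natAdd p j).cast h.symm))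
        (splitAt h x) := by
  refine LinearMap.congr_fun (f := splitAt h ∘ₗ PiTensorProduct.map u)
    (g := TensorProduct.map _ _ ∘ₗ splitAt h)
    (PiTensorProduct.ext (MultilinearMap.ext fun v => ?_)) x
  simp only [LinearMap.compMultilinearMap_apply, LinearMap.comp_apply,
    PiTensorProduct.map_tprod, splitAt_tprod, TensorProduct.map_tmul]

theorem splitAt_injective {N p q : ℕ} (h : N = p + q) :
    Function.Injective (splitAt (K := K) (V := V) h) := by
  rw [splitAt, LinearMap.coe_comp]
  exact (LinearEquiv.injective _).comp (LinearEquiv.injective _)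

/-- The inclusion of the component of bidegree `(p, q)` of `T̄(V) ⊗ T̄(V)`, applied to the splitting
of a tensor. -/
def splitTerm {N p q : ℕ} (h : N + 1 = (p + 1) + (q + 1)) :
    (⨂[K]^(N + 1) V) →ₗ[K] TBar K V ⊗[K] TBar K V :=
  TensorProduct.map (DirectSum.lof K ℕ (fun m => ⨂[K]^(m + 1) V) p)
    (DirectSum.lof K ℕ (fun m => ⨂[K]^(m + 1) V) q) ∘ₗ splitAt h

theorem deconcat_lof (n : ℕ) (t : ⨂[K]^(n + 1) V) :
    deconcat (DirectSum.lof K ℕ (fun m => ⨂[K]^(m + 1) V) n t) =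
      ∑ i : Fin n, splitTerm
        (show n + 1 = ((i : ℕ) + 1) + (n - (i + 1) + 1) by omega) t := by
  rw [deconcat, DirectSum.toModule_lof, LinearMap.sum_apply]
  rfl

theorem TBar.linearMap_ext {M : Type*} [AddCommMonoid M] [Module K M] {f g : TBar K V →ₗ[K] M}
    (h : ∀ n t, f (DirectSum.lof K ℕ (fun m => ⨂[K]^(m + 1) V) n t) =
      g (DirectSum.lof K ℕ (fun m => ⨂[K]^(m + 1) V) n t)) : f = g :=
  DirectSum.linearMap_ext K fun n => LinearMap.ext fun t => h n t

/-- Exactly one cut has pieces of the prescribed lengths. As `splitAt` is injective, a single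
component of `y` can thus be recovered from the coproduct of `y`. -/
theorem map_component_deconcat {N p q : ℕ} (h : N + 1 = (p + 1) + (q + 1)) (y : TBar K V) :
    TensorProduct.map (DirectSum.component K ℕ (fun m => ⨂[K]^(m + 1) V) p)
      (DirectSum.component K ℕ (fun m => ⨂[K]^(m + 1) V) q) (deconcat y) = splitAt h (y N) := by
  refine LinearMap.congr_fun (f := TensorProduct.map _ _ ∘ₗ deconcat)
    (g := splitAt h ∘ₗ DirectSum.component K ℕ (fun m => ⨂[K]^(m + 1) V) N)
    (TBar.linearMap_ext fun n t => ?_) y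
  simp only [LinearMap.comp_apply, deconcat_lof, map_sum, splitTerm]
  simp only [← LinearMap.comp_apply, ← LinearMap.comp_assoc, ← TensorProduct.map_comp,
    DirectSum.component_comp_lof]
  by_cases hn : n = N
  · subst hn
    have hp : p < n := by omega
    rw [Finset.sum_eq_single ⟨p, hp⟩]
    · obtain rfl : q = n - (p + 1) := by omega
      simp
    · intro i _ hi
      have hp : ¬ (i : ℕ) = p := fun e => hi (Fin.ext e)
      simp [hp]
    · simp
  · rw [Finset.sum_eq_zero]
    · simp [hn]
    · intro i _
      by_cases hi : (i : ℕ) = p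
      · have hq : ¬ n - (i + 1) = q := by omega
        simp [hq]
      · simp [hi]

/-- A component of length at least two is determined by its cut after the first factor; the
length-one component is what `tProj` sees. -/
theorem eq_zero_of_deconcat {y : TBar K V} (h0 : tProj y = 0) (h1 : deconcat y = 0) : y = 0 := by
  refine DFinsupp.ext fun m => ?_
  obtain _ | m := m
  · exact (LinearEquiv.map_eq_zero_iff
      (PiTensorProduct.subsingletonEquiv (R := K) (s := fun _ : Fin 1 => V) 0)).1 h0
  · have h : m + 1 + 1 = (0 + 1) + (m + 1) := by omega
    refine splitAt_injective h ?_
    rw [← map_component_deconcat h, h1, map_zero, DFinsupp.zero_apply, map_zero]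

/-- The tensors of length at most `n`. -/
def tFilt (n : ℕ) : Submodule K (TBar K V) :=
  ⨅ m : ℕ, ⨅ _ : n ≤ m, LinearMap.ker (DirectSum.component K ℕ (fun n => ⨂[K]^(n + 1) V) m)

theorem mem_tFilt {n : ℕ} {x : TBar K V} :
    x ∈ tFilt (K := K) (V := V) n ↔ ∀ m, n ≤ m → x m = 0 := by
  simp [tFilt, Submodule.mem_iInf, DirectSum.apply_eq_component K]

theorem mem_tFilt_zero {x : TBar K V} : x ∈ tFilt (K := K) (V := V) 0 ↔ x = 0 := by
  rw [mem_tFilt]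
  exact ⟨fun h => DFinsupp.ext fun m => h m m.zero_le, fun h => by simp [h]⟩

theorem tFilt_mono {m n : ℕ} (h : m ≤ n) : tFilt (K := K) (V := V) m ≤ tFilt n :=
  fun _ hx => mem_tFilt.2 fun k hk => mem_tFilt.1 hx k (h.trans hk)

theorem exists_mem_tFilt (x : TBar K V) : ∃ n, x ∈ tFilt (K := K) (V := V) n := by
  classical
  refine ⟨(DFinsupp.support x).sup id + 1, mem_tFilt.2 fun m hm => ?_⟩
  by_contra h
  have := Finset.le_sup (f := id) (DFinsupp.mem_support_iff.2 h)
  simp only [id] at this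
  omega

theorem lof_mem_tFilt {n m : ℕ} (h : n < m) (t : ⨂[K]^(n + 1) V) :
    DirectSum.lof K ℕ (fun n => ⨂[K]^(n + 1) V) n t ∈ tFilt (K := K) (V := V) m := by
  refine mem_tFilt.2 fun k hk => ?_
  rw [DirectSum.apply_eq_component K, DirectSum.component.of, dif_neg (by omega)]

/-- A submodule that contains all tensors of length at most `n` of a single length contains all
tensors of length at most `n`. -/
theorem mem_of_mem_tFilt {n : ℕ} {x : TBar K V} (hx : x ∈ tFilt (K := K) (V := V) n)
    (P : Submodule K (TBar K V))
    (hP : ∀ m, m < n → ∀ t, DirectSum.lof K ℕ (fun n => ⨂[K]^(n + 1) V) m t ∈ P) : x ∈ P := by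
  classical
  rw [← DirectSum.sum_support_of x]
  refine Submodule.sum_mem _ fun m hm => ?_
  by_cases h : m < n
  · exact hP m h _
  · rw [mem_tFilt.1 hx m (not_lt.1 h)]
    simp

/-- Both pieces of a cut are strictly shorter. Phrased as a range, this lets an induction hypothesis
be applied to each factor of an elementary tensor. -/
theorem deconcat_mem_range {n : ℕ} {x : TBar K V} (hx : x ∈ tFilt (K := K) (V := V) (n + 1)) :
    deconcat x ∈ LinearMap.range
      (TensorProduct.map (tFilt (K := K) (V := V) n).subtype (tFilt (K := K) (V := V) n).subtype) := by
  refine Submodule.mem_comap.1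
    (mem_of_mem_tFilt hx (Submodule.comap deconcat _) fun m hm t => ?_)
  rw [Submodule.mem_comap, deconcat_lof]
  refine Submodule.sum_mem _ fun i _ => ?_
  have h1 : (i : ℕ) < n := by omega
  have h2 : m - (i + 1) < n := by omega
  rw [splitTerm]
  refine ⟨TensorProduct.map ((DirectSum.lof K ℕ (fun m => ⨂[K]^(m + 1) V) i).codRestrict _
    (lof_mem_tFilt h1)) ((DirectSum.lof K ℕ (fun m => ⨂[K]^(m + 1) V) (m - (i + 1))).codRestrict _
    (lof_mem_tFilt h2)) (splitAt (by omega) t), ?_⟩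
  rw [← LinearMap.comp_apply, ← TensorProduct.map_comp, LinearMap.subtype_comp_codRestrict,
    LinearMap.subtype_comp_codRestrict]
  rfl

/-- Two linear maps `F` and `G` into `T̄(V)` agree if they have the same corestriction and their
difference is a coderivation relative to two linear maps. -/
theorem eq_of_leibniz {F G α β : TBar K W →ₗ[K] TBar K V}
    (A B : TBar K W ⊗[K] TBar K W →ₗ[K] TBar K V ⊗[K] TBar K V)
    (h0 : ∀ x, tProj (F x) = tProj (G x))
    (hF : ∀ x, deconcat (F x) = A (deconcat x)) (hG : ∀ x, deconcat (G x) = B (deconcat x))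
    (h : ∀ x y, A (x ⊗ₜ[K] y) =
      B (x ⊗ₜ[K] y) + ((F x - G x) ⊗ₜ[K] α y + β x ⊗ₜ[K] (F y - G y))) (x : TBar K W) :
    F x = G x := by
  obtain ⟨n, hn⟩ := exists_mem_tFilt x
  induction n generalizing x with
  | zero => rw [mem_tFilt_zero.1 hn, map_zero, map_zero]
  | succ n ih =>
    obtain ⟨z, hz⟩ := deconcat_mem_range hn
    -- The coproduct of the difference involves `F - G` only on shorter tensors, where it vanishes
    -- by induction.
    refine sub_eq_zero.1 (eq_zero_of_deconcat (by rw [map_sub, h0, sub_self]) ?_)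
    rw [map_sub, sub_eq_zero, hF, hG, ← hz]
    refine LinearMap.congr_fun (f := A ∘ₗ TensorProduct.map _ _)
      (g := B ∘ₗ TensorProduct.map _ _) (TensorProduct.ext' fun x y => ?_) z
    simp [h, ih _ x.2, ih _ y.2]

theorem eq_zero_of_leibniz {G α β : TBar K W →ₗ[K] TBar K V}
    (A : TBar K W ⊗[K] TBar K W →ₗ[K] TBar K V ⊗[K] TBar K V) (h0 : ∀ x, tProj (G x) = 0)
    (h1 : ∀ x, deconcat (G x) = A (deconcat x))
    (h2 : ∀ x y, A (x ⊗ₜ[K] y) = G x ⊗ₜ[K] α y + β x ⊗ₜ[K] G y) (x : TBar K W) : G x = 0 :=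
  eq_of_leibniz (G := 0) (α := α) (β := β) A 0 (by simpa using h0) h1 (by simp)
    (by simpa using h2) x

end TensorSplitting

end LInfty

namespace LInfty

/-! ### Maps induced on tensor coalgebras, their coproduct rules, degrees and signs. -/

section TensorMaps

variable {K : Type*} [Field K] {V : Type*} [AddCommGroup V] [Module K V]
  {W : Type*} [AddCommGroup W] [Module K W] {U : Type*} [AddCommGroup U] [Module K U]

theorem tMap_lof (f : V →ₗ[K] W) (n : ℕ) (t : ⨂[K]^(n + 1) V) :
    tMap f (DirectSum.lof K ℕ (fun m => ⨂[K]^(m + 1) V) n t) =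
      DirectSum.lof K ℕ (fun m => ⨂[K]^(m + 1) W) n (PiTensorProduct.map (fun _ => f) t) :=
  DirectSum.lmap_lof _ _ _

theorem tMap_comp (g : W →ₗ[K] U) (f : V →ₗ[K] W) : tMap (g ∘ₗ f) = tMap g ∘ₗ tMap f := by
  refine TBar.linearMap_ext fun n t => ?_
  rw [LinearMap.comp_apply, tMap_lof, tMap_lof, tMap_lof, PiTensorProduct.map_comp]
  rfl

theorem tMap_id : tMap (LinearMap.id : V →ₗ[K] V) = LinearMap.id := by
  refine TBar.linearMap_ext fun n t => ?_
  rw [tMap_lof, PiTensorProduct.map_id]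
  rfl

theorem tProj_tMap (f : V →ₗ[K] W) (x : TBar K V) : tProj (tMap f x) = f (tProj x) := by
  refine LinearMap.congr_fun (f := tProj ∘ₗ tMap f) (g := f ∘ₗ tProj) ?_ x
  have h : ∀ t : ⨂[K]^1 V, PiTensorProduct.subsingletonEquiv (R := K) (s := fun _ : Fin 1 => W) 0
      (PiTensorProduct.map (fun _ => f) t) =
      f (PiTensorProduct.subsingletonEquiv (R := K) (s := fun _ : Fin 1 => V) 0 t) := by
    refine LinearMap.congr_fun (f := (PiTensorProduct.subsingletonEquiv (R := K)
      (s := fun _ : Fin 1 => W) 0).toLinearMap ∘ₗ PiTensorProduct.map fun _ => f)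
      (g := f ∘ₗ (PiTensorProduct.subsingletonEquiv (R := K)
        (s := fun _ : Fin 1 => V) 0).toLinearMap) ?_
    refine PiTensorProduct.ext (MultilinearMap.ext fun v => ?_)
    simp
  exact LinearMap.ext fun x => h (x 0)

theorem deconcat_comp_tMap (f : V →ₗ[K] W) :
    deconcat ∘ₗ tMap f = TensorProduct.map (tMap f) (tMap f) ∘ₗ deconcat := by
  refine TBar.linearMap_ext fun n t => ?_
  rw [LinearMap.comp_apply, LinearMap.comp_apply, tMap_lof, deconcat_lof, deconcat_lof, map_sum]
  refine Finset.sum_congr rfl fun i _ => ?_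
  simp only [splitTerm, LinearMap.comp_apply, splitAt_map]
  generalize splitAt (K := K) (V := V) _ t = z
  induction z using TensorProduct.induction_on with
  | zero => simp
  | add x y hx hy => simp only [map_add, hx, hy]
  | tmul a b => simp only [TensorProduct.map_tmul, tMap_lof]

variable (𝓥 : ℤ → Submodule K V)

theorem hasDegree_tGrading {M : Type*} [AddCommGroup M] [Module K M] {𝓜 : ℤ → Submodule K M}
    {e : ℤ} {f : TBar K V →ₗ[K] M}
    (h : ∀ (n : ℕ) (a : Fin (n + 1) → ℤ) (v : Fin (n + 1) → V), (∀ i, v i ∈ 𝓥 (a i)) →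
      f (DirectSum.lof K ℕ (fun n => ⨂[K]^(n + 1) V) n (PiTensorProduct.tprod K v)) ∈
        𝓜 (∑ i, a i + e)) : HasDegree (tGrading 𝓥) 𝓜 e f := by
  intro k x hx
  refine Submodule.span_le (p := (𝓜 (k + e)).comap f).2 ?_ hx
  rintro _ ⟨n, a, v, hv, rfl, rfl⟩
  exact h n a v hv

theorem hasDegree_tMap (𝓦 : ℤ → Submodule K W) {f : V →ₗ[K] W} (hf : HasDegree 𝓥 𝓦 0 f) :
    HasDegree (tGrading 𝓥) (tGrading 𝓦) 0 (tMap f) := by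
  refine hasDegree_tGrading 𝓥 fun n a v hv => ?_
  rw [tMap_lof, PiTensorProduct.map_tprod]
  exact Submodule.subset_span ⟨n, a, _, fun i => by simpa using hf _ _ (hv i), by simp, rfl⟩

variable [DirectSum.Decomposition 𝓥]

/-- The component `∑_{i=1}^n f^{⊗(i-1)} ⊗ g ⊗ Id^{⊗(n-i)}` of `tInsert`. -/
def insertPower (f g : V →ₗ[K] V) (n : ℕ) : (⨂[K]^n V) →ₗ[K] ⨂[K]^n V :=
  ∑ i : Fin n, PiTensorProduct.map fun j =>
    if j < i then f ∘ₗ signOp 𝓥 else if j = i then g else LinearMap.id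

theorem tInsert_lof (f g : V →ₗ[K] V) (n : ℕ) (t : ⨂[K]^(n + 1) V) :
    tInsert 𝓥 f g (DirectSum.lof K ℕ (fun m => ⨂[K]^(m + 1) V) n t) =
      DirectSum.lof K ℕ (fun m => ⨂[K]^(m + 1) V) n (insertPower 𝓥 f g (n + 1) t) :=
  DirectSum.lmap_lof _ _ _

theorem tInsert_mem_tFilt (f g : V →ₗ[K] V) {n : ℕ} {x : TBar K V}
    (hx : x ∈ tFilt (K := K) (V := V) n) : tInsert 𝓥 f g x ∈ tFilt (K := K) (V := V) n := by
  refine mem_tFilt.2 fun m hm => ?_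
  rw [tInsert, DirectSum.lmap_apply, mem_tFilt.1 hx m hm, map_zero]

theorem tMap_mem_tFilt (f : V →ₗ[K] W) {n : ℕ} {x : TBar K V}
    (hx : x ∈ tFilt (K := K) (V := V) n) : tMap f x ∈ tFilt (K := K) (V := W) n := by
  refine mem_tFilt.2 fun m hm => ?_
  rw [tMap, DirectSum.lmap_apply, mem_tFilt.1 hx m hm, map_zero]

theorem tProj_tInsert (f g : V →ₗ[K] V) (x : TBar K V) :
    tProj (tInsert 𝓥 f g x) = g (tProj x) := by
  refine LinearMap.congr_fun (f := tProj ∘ₗ tInsert 𝓥 f g) (g := tProj ∘ₗ tMap g) ?_ x |>.trans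
    (tProj_tMap g x)
  refine LinearMap.ext fun x => ?_
  have h : insertPower 𝓥 f g 1 = PiTensorProduct.map fun _ => g := by
    rw [insertPower, Fin.sum_univ_one]
    congr 1
    funext j
    simp [Subsingleton.elim j 0]
  exact congrArg _ (LinearMap.congr_fun h (x 0))

/-- The position of `g` lies either in the left block, leaving the right block untouched, or in the
right block, and then every factor on the left carries `f` and a sign. -/
theorem splitAt_insertPower (f g : V →ₗ[K] V) {N p q : ℕ} (h : N = p + q) (t : ⨂[K]^N V) :
    splitAt h (insertPower 𝓥 f g N t) =
      TensorProduct.map (insertPower 𝓥 f g p) LinearMap.id (splitAt h t) +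
      TensorProduct.map (PiTensorProduct.map fun _ => f ∘ₗ signOp 𝓥) (insertPower 𝓥 f g q)
        (splitAt h t) := by
  subst h
  have h1 : ∀ (i : Fin p) (j : Fin q), ¬ Fin.natAdd p j < Fin.castAdd q i := fun i j => by
    simp only [Fin.lt_def, Fin.val_natAdd, Fin.val_castAdd]; omega
  have h1' : ∀ (i : Fin p) (j : Fin q), Fin.castAdd q i < Fin.natAdd p j := fun i j => by
    simp only [Fin.lt_def, Fin.val_natAdd, Fin.val_castAdd]; omega
  have h2 : ∀ i j : Fin p, Fin.castAdd q i < Fin.castAdd q j ↔ i < j := fun i j => by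
    simp only [Fin.lt_def, Fin.val_castAdd]
  have h3 : ∀ i j : Fin q, Fin.natAdd p i < Fin.natAdd p j ↔ i < j := fun i j => by
    simp only [Fin.lt_def, Fin.val_natAdd]; omega
  have h4 : ∀ (i : Fin p) (j : Fin q), ¬ Fin.natAdd p j = Fin.castAdd q i := fun i j =>
    (h1' i j).ne'
  simp only [insertPower, LinearMap.add_apply, LinearMap.sum_apply, map_add, map_sum,
    Fin.sum_univ_add, splitAt_map,
    Fin.cast_eq_self, h1, h1', h2, h3, h4, if_true, if_false, Fin.castAdd_inj, Fin.natAdd_inj,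
    PiTensorProduct.map_id]
  generalize splitAt (K := K) (V := V) _ t = z
  induction z with
  | zero => simp
  | add x y hx hy =>
    simp only [map_add, Finset.sum_add_distrib] at hx hy ⊢
    rw [add_add_add_comm, hx, hy, add_add_add_comm]
  | tmul a b =>
    simp only [TensorProduct.map_tmul, LinearMap.sum_apply, TensorProduct.sum_tmul,
      TensorProduct.tmul_sum]

/-- A common source for two rules: `f = id` gives the coderivation property of the differential, `f
= ι ∘ π` the coproduct rule of the homotopy. -/
theorem deconcat_comp_tInsert (f g : V →ₗ[K] V) :
    deconcat ∘ₗ tInsert 𝓥 f g =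
      (TensorProduct.map (tInsert 𝓥 f g) LinearMap.id +
        TensorProduct.map (tMap f ∘ₗ tSign 𝓥) (tInsert 𝓥 f g)) ∘ₗ deconcat := by
  refine TBar.linearMap_ext fun n t => ?_
  rw [tSign, ← tMap_comp, LinearMap.comp_apply, LinearMap.comp_apply, tInsert_lof, deconcat_lof,
    deconcat_lof, map_sum]
  refine Finset.sum_congr rfl fun i _ => ?_
  simp only [splitTerm, LinearMap.comp_apply, splitAt_insertPower]
  generalize splitAt (K := K) (V := V) _ t = z
  induction z with
  | zero => simp
  | add x y hx hy =>
    simp only [map_add] at hx hy ⊢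
    rw [add_add_add_comm, hx, hy]
  | tmul a b =>
    simp only [TensorProduct.map_tmul, LinearMap.add_apply, tMap_lof, tInsert_lof, map_add,
      LinearMap.id_apply]

/-! Degrees and signs -/

theorem HasDegree.comp {M N P : Type*} [AddCommMonoid M] [Module K M] [AddCommMonoid N]
    [Module K N] [AddCommMonoid P] [Module K P] {𝓜 : ℤ → Submodule K M} {𝓝 : ℤ → Submodule K N}
    {𝓟 : ℤ → Submodule K P} {m n : ℤ} {g : N →ₗ[K] P} {f : M →ₗ[K] N} (hg : HasDegree 𝓝 𝓟 n g)
    (hf : HasDegree 𝓜 𝓝 m f) : HasDegree 𝓜 𝓟 (m + n) (g ∘ₗ f) := fun i x hx => by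
  rw [← add_assoc]
  exact hg _ _ (hf i x hx)

theorem HasDegree.add {M N : Type*} [AddCommMonoid M] [Module K M] [AddCommMonoid N]
    [Module K N] {𝓜 : ℤ → Submodule K M} {𝓝 : ℤ → Submodule K N} {n : ℤ}
    {f g : M →ₗ[K] N} (hf : HasDegree 𝓜 𝓝 n f) (hg : HasDegree 𝓜 𝓝 n g) :
    HasDegree 𝓜 𝓝 n (f + g) := fun i x hx =>
  Submodule.add_mem _ (hf i x hx) (hg i x hx)

theorem HasDegree.sub {M N : Type*} [AddCommGroup M] [Module K M] [AddCommGroup N]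
    [Module K N] {𝓜 : ℤ → Submodule K M} {𝓝 : ℤ → Submodule K N} {n : ℤ}
    {f g : M →ₗ[K] N} (hf : HasDegree 𝓜 𝓝 n f) (hg : HasDegree 𝓜 𝓝 n g) :
    HasDegree 𝓜 𝓝 n (f - g) := fun i x hx =>
  Submodule.sub_mem _ (hf i x hx) (hg i x hx)

/-- Expanding every factor into homogeneous components shows that homogeneous tensors span, so no
decomposition of `TBar K V` by total degree is needed. -/
theorem tGrading_induction (P : Submodule K (TBar K V))
    (h : ∀ k, tGrading 𝓥 k ≤ P) (x : TBar K V) : x ∈ P := by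
  classical
  -- Membership is recast as vanishing of the quotient map, so that extensionality for linear maps
  -- reduces it to pure tensors.
  suffices LinearMap.id.comp P.mkQ = 0 by
    have := LinearMap.congr_fun this x
    simpa using this
  refine TBar.linearMap_ext fun n t => ?_
  refine LinearMap.congr_fun (f := LinearMap.id ∘ₗ P.mkQ ∘ₗ
    DirectSum.lof K ℕ (fun m => ⨂[K]^(m + 1) V) n) (g := 0)
    (PiTensorProduct.ext (MultilinearMap.ext fun v => ?_)) t
  simp only [LinearMap.compMultilinearMap_apply, LinearMap.comp_apply, LinearMap.id_apply,
    Submodule.mkQ_apply, LinearMap.zero_apply, Submodule.Quotient.mk_eq_zero]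
  have hv : v = fun i => ∑ j ∈ (DirectSum.decompose 𝓥 (v i)).support,
      (DirectSum.decompose 𝓥 (v i) j : V) :=
    funext fun i => (DirectSum.sum_support_decompose 𝓥 (v i)).symm
  rw [hv, MultilinearMap.map_sum_finset, map_sum]
  refine Submodule.sum_mem _ fun r _ => h _ (Submodule.subset_span
    ⟨n, r, _, fun i => SetLike.coe_mem _, rfl, rfl⟩)

theorem hasDegree_tInsert {f g : V →ₗ[K] V} {e : ℤ} (hf : HasDegree 𝓥 𝓥 0 f)
    (hg : HasDegree 𝓥 𝓥 e g) : HasDegree (tGrading 𝓥) (tGrading 𝓥) e (tInsert 𝓥 f g) := by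
  refine hasDegree_tGrading 𝓥 fun n a v hv => ?_
  rw [tInsert_lof, insertPower, LinearMap.sum_apply, map_sum]
  refine Submodule.sum_mem _ fun i _ => ?_
  rw [PiTensorProduct.map_tprod]
  refine Submodule.subset_span ⟨n, fun j => a j + if j = i then e else 0, _, fun j => ?_, ?_, rfl⟩
  · by_cases h : j = i
    · subst h
      simpa using hg _ _ (hv j)
    · by_cases h' : j < i
      · simp only [h, h', if_true, if_false, LinearMap.comp_apply, signOp_of_mem 𝓥 (hv j), map_zsmul]
        exact zsmul_mem (hf _ _ (hv j)) _
      · simpa [h, h'] using hv j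
  · simp [Finset.sum_add_distrib]

variable (𝓦 : ℤ → Submodule K W) [DirectSum.Decomposition 𝓦]

theorem comp_tSign_of_hasDegree {f : TBar K V →ₗ[K] TBar K W} {e : ℤ}
    (hf : HasDegree (tGrading 𝓥) (tGrading 𝓦) e f) :
    tSign 𝓦 ∘ₗ f = ((e.negOnePow : ℤ) : K) • (f ∘ₗ tSign 𝓥) := by
  refine LinearMap.ext fun x => ?_
  refine tGrading_induction 𝓥 (LinearMap.eqLocus (tSign 𝓦 ∘ₗ f)
    (((e.negOnePow : ℤ) : K) • (f ∘ₗ tSign 𝓥))) (fun k x hx => ?_) x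
  rw [LinearMap.mem_eqLocus, LinearMap.comp_apply, LinearMap.smul_apply, LinearMap.comp_apply,
    tSign_of_mem 𝓥 hx, tSign_of_mem 𝓦 (hf k x hx), map_smul, smul_smul, Int.negOnePow_add]
  push_cast
  rw [mul_comm]

theorem tSign_comp_even {f : TBar K V →ₗ[K] TBar K W}
    (hf : HasDegree (tGrading 𝓥) (tGrading 𝓦) 0 f) (x : TBar K V) :
    tSign 𝓦 (f x) = f (tSign 𝓥 x) := by
  simpa using LinearMap.congr_fun (comp_tSign_of_hasDegree 𝓥 𝓦 hf) x

theorem tSign_comp_odd {f : TBar K V →ₗ[K] TBar K W} {e : ℤ} (he : Odd e)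
    (hf : HasDegree (tGrading 𝓥) (tGrading 𝓦) e f) (x : TBar K V) :
    tSign 𝓦 (f x) = -f (tSign 𝓥 x) := by
  simpa [Int.negOnePow_odd e he] using LinearMap.congr_fun (comp_tSign_of_hasDegree 𝓥 𝓦 hf) x

theorem signOp_signOp (v : V) : signOp 𝓥 (signOp 𝓥 v) = v := by
  refine LinearMap.congr_fun (f := signOp 𝓥 ∘ₗ signOp 𝓥) (g := LinearMap.id)
    (linearMap_ext_homogeneous 𝓥 fun i v hv => ?_) v
  rw [LinearMap.comp_apply, signOp_of_mem 𝓥 hv, map_zsmul, signOp_of_mem 𝓥 hv, smul_smul,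
    ← Units.val_mul, ← Int.negOnePow_add, Int.negOnePow_even _ (⟨i, rfl⟩)]
  simp

theorem tSign_tSign (x : TBar K V) : tSign 𝓥 (tSign 𝓥 x) = x := by
  rw [tSign, ← LinearMap.comp_apply, ← tMap_comp,
    show signOp 𝓥 ∘ₗ signOp 𝓥 = LinearMap.id from LinearMap.ext (signOp_signOp 𝓥), tMap_id]
  rfl

end TensorMaps

end LInfty

namespace LInfty

/-! ### The tensor coalgebra contraction, and coderivations without linear part. -/

section TensorContraction

variable {K : Type*} [Field K] {V : Type*} [AddCommGroup V] [Module K V]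
  {W : Type*} [AddCommGroup W] [Module K W]

theorem IsCoderivation.comul_apply {C : Type*} [AddCommMonoid C] [Module K C]
    {𝓒 : ℤ → Submodule K C} {ε : C →ₗ[K] C} {Δ : C →ₗ[K] C ⊗[K] C} {Q : C →ₗ[K] C}
    (hQ : IsCoderivation 𝓒 ε Δ Q) (x : C) :
    Δ (Q x) =
      (TensorProduct.map Q LinearMap.id + TensorProduct.map ε Q : C ⊗[K] C →ₗ[K] C ⊗[K] C) (Δ x) :=
  LinearMap.congr_fun hQ.leibniz x

theorem IsCoderivation.sub {C : Type*} [AddCommGroup C] [Module K C]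
    {𝓒 : ℤ → Submodule K C} {ε : C →ₗ[K] C} {Δ : C →ₗ[K] C ⊗[K] C} {Q R : C →ₗ[K] C}
    (hQ : IsCoderivation 𝓒 ε Δ Q) (hR : IsCoderivation 𝓒 ε Δ R) :
    IsCoderivation 𝓒 ε Δ (Q - R) where
  degree := hQ.degree.sub hR.degree
  leibniz := by
    rw [LinearMap.comp_sub, hQ.leibniz, hR.leibniz, ← LinearMap.sub_comp]
    congr 1
    refine TensorProduct.ext' fun a b => ?_
    simp only [LinearMap.sub_apply, LinearMap.add_apply, TensorProduct.map_tmul,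
      TensorProduct.sub_tmul, TensorProduct.tmul_sub]
    abel

theorem IsCoderivation.add {C : Type*} [AddCommMonoid C] [Module K C]
    {𝓒 : ℤ → Submodule K C} {ε : C →ₗ[K] C} {Δ : C →ₗ[K] C ⊗[K] C} {Q R : C →ₗ[K] C}
    (hQ : IsCoderivation 𝓒 ε Δ Q) (hR : IsCoderivation 𝓒 ε Δ R) :
    IsCoderivation 𝓒 ε Δ (Q + R) where
  degree := hQ.degree.add hR.degree
  leibniz := by
    rw [LinearMap.comp_add, hQ.leibniz, hR.leibniz, ← LinearMap.add_comp]
    congr 1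
    refine TensorProduct.ext' fun a b => ?_
    simp only [LinearMap.add_apply, TensorProduct.map_tmul,
      TensorProduct.add_tmul, TensorProduct.tmul_add]
    abel

theorem isCoalgebraHom_tMap (𝓥 : ℤ → Submodule K V)
    (𝓦 : ℤ → Submodule K W) {f : V →ₗ[K] W} (hf : HasDegree 𝓥 𝓦 0 f) :
    IsCoalgebraHom (tGrading 𝓥) deconcat (tGrading 𝓦) deconcat (tMap f) where
  degree := hasDegree_tMap 𝓥 𝓦 hf
  comul := deconcat_comp_tMap f

variable (𝓥 : ℤ → Submodule K V) [DirectSum.Decomposition 𝓥]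
  (𝓦 : ℤ → Submodule K W) [DirectSum.Decomposition 𝓦]

theorem isCoderivation_tDiff {d : V →ₗ[K] V} (hd : HasDegree 𝓥 𝓥 1 d) :
    IsCoderivation (tGrading 𝓥) (tSign 𝓥) deconcat (tDiff 𝓥 d) where
  degree := hasDegree_tInsert 𝓥 (fun i x hx => by simpa using hx) hd
  leibniz := by
    rw [tDiff, deconcat_comp_tInsert, tMap_id, LinearMap.id_comp]

variable {𝓥 𝓦}

/-- An odd `Q` anticommutes with the sign operator, so the cross terms in the square of `Q ⊗ 1 + ε ⊗
Q` cancel. The square of `Q` is thus a coderivation without signs, determined by its corestriction.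
-/
theorem IsCoderivation.comp_self_eq_zero {Q : TBar K V →ₗ[K] TBar K V}
    (hQ : IsCoderivation (tGrading 𝓥) (tSign 𝓥) deconcat Q) (h0 : ∀ x, tProj (Q (Q x)) = 0) :
    Q ∘ₗ Q = 0 := by
  set D := TensorProduct.map Q LinearMap.id + TensorProduct.map (tSign 𝓥) Q with hD
  refine LinearMap.ext (eq_zero_of_leibniz (G := Q ∘ₗ Q) (α := LinearMap.id) (β := LinearMap.id)
    (D ∘ₗ D) h0 (fun x => ?_) fun x y => ?_)
  · simp only [LinearMap.comp_apply, hQ.comul_apply, ← hD]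
  · simp only [hD, LinearMap.comp_apply, LinearMap.add_apply, TensorProduct.map_tmul, map_add,
      LinearMap.id_apply, tSign_comp_odd 𝓥 𝓥 odd_one hQ.degree, tSign_tSign,
      TensorProduct.neg_tmul]
    abel

/-- Both composites are coderivations along `F`, hence determined by their corestrictions. -/
theorem IsCoderivation.comp_hom_eq {F : TBar K V →ₗ[K] TBar K W} {d : TBar K V →ₗ[K] TBar K V}
    {d' : TBar K W →ₗ[K] TBar K W}
    (hF : IsCoalgebraHom (tGrading 𝓥) deconcat (tGrading 𝓦) deconcat F)
    (hd : IsCoderivation (tGrading 𝓥) (tSign 𝓥) deconcat d)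
    (hd' : IsCoderivation (tGrading 𝓦) (tSign 𝓦) deconcat d')
    (h0 : ∀ x, tProj (d' (F x)) = tProj (F (d x))) : d' ∘ₗ F = F ∘ₗ d := by
  have hF' : ∀ x, deconcat (F x) = TensorProduct.map F F (deconcat x) :=
    LinearMap.congr_fun hF.comul
  set D := TensorProduct.map d LinearMap.id + TensorProduct.map (tSign 𝓥) d with hD
  set D' := TensorProduct.map d' LinearMap.id + TensorProduct.map (tSign 𝓦) d' with hD'
  refine LinearMap.ext (eq_of_leibniz (F := d' ∘ₗ F) (G := F ∘ₗ d) (α := F) (β := F ∘ₗ tSign 𝓥)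
    (D' ∘ₗ TensorProduct.map F F) (TensorProduct.map F F ∘ₗ D) h0 (fun x => ?_) (fun x => ?_)
    fun x y => ?_)
  · simp only [LinearMap.comp_apply, hF', hd'.comul_apply, ← hD']
  · simp only [LinearMap.comp_apply, hF', hd.comul_apply, ← hD]
  · simp only [hD, hD', LinearMap.comp_apply, LinearMap.add_apply,
      TensorProduct.map_tmul, map_add, LinearMap.id_apply, tSign_comp_even 𝓥 𝓦 hF.degree,
      TensorProduct.sub_tmul, TensorProduct.tmul_sub]
    abel

theorem isCoalgebraContraction_tMap {dW : W →ₗ[K] W} {dV : V →ₗ[K] V} {ι : W →ₗ[K] V}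
    {π : V →ₗ[K] W} {k : V →ₗ[K] V} (hk : IsContraction 𝓦 dW 𝓥 dV ι π k) :
    IsCoalgebraContraction (tGrading 𝓦) (tSign 𝓦) deconcat (tDiff 𝓦 dW)
      (tGrading 𝓥) (tSign 𝓥) deconcat (tDiff 𝓥 dV) (tMap ι) (tMap π) (tHomotopy 𝓥 ι π k) := by
  have hdW := isCoderivation_tDiff 𝓦 hk.degree_dM
  have hdV := isCoderivation_tDiff 𝓥 hk.degree_dN
  have hI := isCoalgebraHom_tMap 𝓦 𝓥 hk.degree_ι
  have hP := isCoalgebraHom_tMap 𝓥 𝓦 hk.degree_π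
  have hιπ : HasDegree 𝓥 𝓥 0 (ι ∘ₗ π) := by simpa using hk.degree_ι.comp hk.degree_π
  have hh : HasDegree (tGrading 𝓥) (tGrading 𝓥) (-1) (tHomotopy 𝓥 ι π k) :=
    hasDegree_tInsert 𝓥 hιπ hk.degree_h
  have pW : ∀ x, tProj (tDiff 𝓦 dW x) = dW (tProj x) := tProj_tInsert 𝓦 _ _
  have pV : ∀ x, tProj (tDiff 𝓥 dV x) = dV (tProj x) := tProj_tInsert 𝓥 _ _
  have pI : ∀ x, tProj (tMap ι x) = ι (tProj x) := tProj_tMap ι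
  have pP : ∀ x, tProj (tMap π x) = π (tProj x) := tProj_tMap π
  have ph : ∀ x, tProj (tHomotopy 𝓥 ι π k x) = k (tProj x) := tProj_tInsert 𝓥 _ _
  have hcomul : deconcat ∘ₗ tHomotopy 𝓥 ι π k =
      (TensorProduct.map (tMap ι ∘ₗ tMap π ∘ₗ tSign 𝓥) (tHomotopy 𝓥 ι π k) +
        TensorProduct.map (tHomotopy 𝓥 ι π k) LinearMap.id) ∘ₗ deconcat := by
    rw [tHomotopy, deconcat_comp_tInsert, add_comm, tMap_comp, LinearMap.comp_assoc]
  have hPI : ∀ x, tMap π (tMap ι x) = x := fun x => by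
    rw [← LinearMap.comp_apply, ← tMap_comp, hk.π_ι, tMap_id, LinearMap.id_apply]
  have dsqW : tDiff 𝓦 dW ∘ₗ tDiff 𝓦 dW = 0 := hdW.comp_self_eq_zero fun x => by
    simp only [pW]
    exact LinearMap.congr_fun hk.dM_sq _
  have dsqV : tDiff 𝓥 dV ∘ₗ tDiff 𝓥 dV = 0 := hdV.comp_self_eq_zero fun x => by
    simp only [pV]
    exact LinearMap.congr_fun hk.dN_sq _
  have dI : tDiff 𝓥 dV ∘ₗ tMap ι = tMap ι ∘ₗ tDiff 𝓦 dW :=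
    IsCoderivation.comp_hom_eq hI hdW hdV fun x => by
      simp only [pV, pI, pW]
      exact LinearMap.congr_fun hk.ι_comm _
  have dP : tDiff 𝓦 dW ∘ₗ tMap π = tMap π ∘ₗ tDiff 𝓥 dV :=
    IsCoderivation.comp_hom_eq hP hdV hdW fun x => by
      simp only [pV, pP, pW]
      exact LinearMap.congr_fun hk.π_comm _
  have sI := tSign_comp_even 𝓦 𝓥 hI.degree
  have sP := tSign_comp_even 𝓥 𝓦 hP.degree
  have sd := tSign_comp_odd 𝓥 𝓥 odd_one hdV.degree
  have sh := tSign_comp_odd 𝓥 𝓥 (by decide) hh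
  have ss := tSign_tSign 𝓥
  set I := tMap ι
  set P := tMap π
  set d := tDiff 𝓥 dV
  set h := tHomotopy 𝓥 ι π k
  set ε := tSign 𝓥
  clear_value I P d h ε
  have cI : ∀ x, deconcat (I x) = TensorProduct.map I I (deconcat x) :=
    LinearMap.congr_fun hI.comul
  have cP : ∀ x, deconcat (P x) = TensorProduct.map P P (deconcat x) :=
    LinearMap.congr_fun hP.comul
  set H := TensorProduct.map (I ∘ₗ P ∘ₗ ε) h + TensorProduct.map h LinearMap.id with hH
  set D := TensorProduct.map d LinearMap.id + TensorProduct.map ε d with hD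
  have ch : ∀ x, deconcat (h x) = H (deconcat x) := LinearMap.congr_fun hcomul
  have cd : ∀ x, deconcat (d x) = D (deconcat x) := hdV.comul_apply
  have hPh : ∀ x, P (h x) = 0 :=
    eq_zero_of_leibniz (G := P ∘ₗ h) (α := P) (β := P ∘ₗ ε)
      (TensorProduct.map P P ∘ₗ H)
      (fun x => by
        simp only [LinearMap.comp_apply, pP, ph]
        exact LinearMap.congr_fun hk.π_h _)
      (fun x => by simp only [LinearMap.comp_apply, cP, ch])
      fun x y => by
        simp only [hH, LinearMap.comp_apply, LinearMap.add_apply, TensorProduct.map_tmul, map_add,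
          LinearMap.id_apply, hPI]
        rw [add_comm]
  have hhI : ∀ x, h (I x) = 0 :=
    eq_zero_of_leibniz (G := h ∘ₗ I) (α := I) (β := I ∘ₗ tSign 𝓦)
      (H ∘ₗ TensorProduct.map I I)
      (fun x => by
        simp only [LinearMap.comp_apply, pI, ph]
        exact LinearMap.congr_fun hk.h_ι _)
      (fun x => by simp only [LinearMap.comp_apply, cI, ch])
      fun x y => by
        simp only [hH, LinearMap.comp_apply, LinearMap.add_apply, TensorProduct.map_tmul,
          LinearMap.id_apply, sI, hPI]
        rw [add_comm]
  -- The cross terms of `H ∘ H` vanish by the two preceding identities, leaving `h² ⊗ 1 + IP ⊗ h²`.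
  have hhh : ∀ x, h (h x) = 0 :=
    eq_zero_of_leibniz (G := h ∘ₗ h) (α := LinearMap.id) (β := I ∘ₗ P)
      (H ∘ₗ H)
      (fun x => by
        simp only [LinearMap.comp_apply, ph]
        exact LinearMap.congr_fun hk.h_h _)
      (fun x => by simp only [LinearMap.comp_apply, ch])
      fun x y => by
        simp only [hH, LinearMap.comp_apply, LinearMap.add_apply, TensorProduct.map_tmul, map_add,
          LinearMap.id_apply, sI, sP, sh, hPI, hPh, hhI, ss, map_zero, map_neg,
          neg_zero, TensorProduct.zero_tmul]
        abel
  have hd' : ∀ x, d (I x) = I (tDiff 𝓦 dW x) := LinearMap.congr_fun dI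
  have hd'' : ∀ x, tDiff 𝓦 dW (P x) = P (d x) := LinearMap.congr_fun dP
  -- Put `G = 1 + dh + hd`. The comparison rests on `IP ⊗ IP - (1 ⊗ 1 + DH + HD) = (IP - G) ⊗ 1 + IP
  -- ⊗ (IP - G)`; the mixed terms of `DH + HD` cancel by signs and because `d` commutes with `IP`.
  have hhom : I ∘ₗ P = LinearMap.id + (d ∘ₗ h + h ∘ₗ d) := by
    refine LinearMap.ext (eq_of_leibniz (α := LinearMap.id) (β := I ∘ₗ P)
      (TensorProduct.map I I ∘ₗ TensorProduct.map P P) (LinearMap.id + (D ∘ₗ H + H ∘ₗ D))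
      (fun x => by
        have := LinearMap.congr_fun hk.homotopy (tProj x)
        simp only [LinearMap.comp_apply, LinearMap.sub_apply, LinearMap.add_apply,
          map_add, pI, pP, pV, ph, LinearMap.id_apply] at this ⊢
        rw [← this, add_sub_cancel])
      (fun x => by simp only [LinearMap.comp_apply, cI, cP])
      (fun x => by
        simp only [LinearMap.comp_apply, LinearMap.add_apply, map_add, ch, cd,
          LinearMap.id_apply])
      fun x y => by
        simp only [hH, hD, LinearMap.comp_apply, LinearMap.add_apply, map_add,
          TensorProduct.map_tmul, LinearMap.id_apply, sI, sP, sd, sh, hd', hd'', ss,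
          TensorProduct.sub_tmul, TensorProduct.tmul_sub, TensorProduct.add_tmul,
          TensorProduct.tmul_add, TensorProduct.neg_tmul, map_neg]
        abel)
  exact
    { degree_dM := hdW.degree
      dM_sq := dsqW
      degree_dN := hdV.degree
      dN_sq := dsqV
      degree_ι := hI.degree
      ι_comm := dI
      degree_π := hP.degree
      π_comm := dP
      degree_h := hh
      π_ι := LinearMap.ext hPI
      homotopy := LinearMap.ext fun x => sub_eq_iff_eq_add'.2 (LinearMap.congr_fun hhom x)
      π_h := LinearMap.ext hPh
      h_ι := LinearMap.ext hhI
      h_h := LinearMap.ext hhh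
      codifferential_dM := { hdW with sq_zero := dsqW }
      codifferential_dN := { hdV with sq_zero := dsqV }
      hom_ι := hI
      hom_π := hP
      comul_h := hcomul }

/-- A coderivation (relative to a linear map `β`) of `T̄(V)` without linear part lowers the length
of tensors. -/
theorem mem_tFilt_of_linearPart_eq_zero {δ β : TBar K V →ₗ[K] TBar K V}
    (hδ : deconcat ∘ₗ δ =
      (TensorProduct.map δ LinearMap.id + TensorProduct.map β δ) ∘ₗ deconcat)
    (h0 : linearPart δ = 0) (n : ℕ) (t : ⨂[K]^(n + 1) V) :
    δ (DirectSum.lof K ℕ (fun n => ⨂[K]^(n + 1) V) n t) ∈ tFilt (K := K) (V := V) n := by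
  induction n using Nat.strong_induction_on with
  | _ n ih =>
    refine mem_tFilt.2 fun m hm => ?_
    obtain _ | m := m
    · obtain rfl : n = 0 := by omega
      have ht := LinearMap.congr_fun h0
        (PiTensorProduct.subsingletonEquiv (R := K) (s := fun _ : Fin 1 => V) 0 t)
      simp only [linearPart, tIncl, LinearMap.comp_apply, LinearEquiv.coe_coe,
        LinearEquiv.symm_apply_apply, LinearMap.zero_apply] at ht
      exact (LinearEquiv.map_eq_zero_iff
        (PiTensorProduct.subsingletonEquiv (R := K) (s := fun _ : Fin 1 => V) 0)).1 ht
    -- Cutting after the first factor reduces the claim to the coproduct components with a left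
    -- piece of length one.
    · have h : m + 1 + 1 = (0 + 1) + (m + 1) := by omega
      refine splitAt_injective h ?_
      rw [map_zero, ← map_component_deconcat h, ← LinearMap.comp_apply deconcat, hδ,
        LinearMap.comp_apply, deconcat_lof, map_sum, map_sum]
      refine Finset.sum_eq_zero fun i _ => ?_
      rw [splitTerm, LinearMap.comp_apply]
      generalize splitAt (K := K) (V := V) _ t = z
      induction z using TensorProduct.induction_on with
      | zero => simp
      | add x y hx hy => rw [map_add, map_add, map_add, hx, hy, add_zero]
      | tmul a b =>
        have h1 : DirectSum.component K ℕ (fun m => ⨂[K]^(m + 1) V) m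
            (δ (DirectSum.lof K ℕ (fun m => ⨂[K]^(m + 1) V) (n - (i + 1)) b)) = 0 :=
          mem_tFilt.1 (ih _ (by omega) b) m (by omega)
        rw [TensorProduct.map_tmul, LinearMap.add_apply, map_add, TensorProduct.map_tmul,
          TensorProduct.map_tmul, TensorProduct.map_tmul, TensorProduct.map_tmul, h1,
          TensorProduct.tmul_zero, add_zero, LinearMap.id_apply]
        -- In the term `δ a ⊗ b`: if `a` has length one, `δ a` vanishes in length one by induction;
        -- otherwise `b` is too short to have a component of index `m`.
        by_cases hi : (i : ℕ) = 0
        · have h2 : DirectSum.component K ℕ (fun m => ⨂[K]^(m + 1) V) 0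
              (δ (DirectSum.lof K ℕ (fun m => ⨂[K]^(m + 1) V) i a)) = 0 :=
            mem_tFilt.1 (ih _ (by omega) a) 0 hi.le
          rw [h2, TensorProduct.zero_tmul]
        · rw [DirectSum.component.of, dif_neg (by omega), TensorProduct.tmul_zero]

end TensorContraction

end LInfty

namespace LInfty

/-! ### Locally nilpotent geometric series and the perturbed chain map. -/

section Perturbation

variable {K : Type*} [Field K] {M N : Type*} [AddCommGroup M] [Module K M] [AddCommGroup N]
  [Module K N]

theorem exists_isPointwiseSum {f : ℕ → M →ₗ[K] N}
    (hf : ∀ x, (Function.support fun n => f n x).Finite) : ∃ F, IsPointwiseSum f F :=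
  ⟨{ toFun := fun x => ∑ᶠ n, f n x
     map_add' := fun x y => by
       simp only [map_add]
       exact finsum_add_distrib (hf x) (hf y)
     map_smul' := fun c x => by
       simp only [map_smul, RingHom.id_apply]
       exact (smul_finsum' c (hf x)).symm }, fun x => ⟨hf x, rfl⟩⟩

theorem IsPointwiseSum.comp_left {P : Type*} [AddCommGroup P] [Module K P] {f : ℕ → M →ₗ[K] N}
    {F : M →ₗ[K] N} (hF : IsPointwiseSum f F) (g : N →ₗ[K] P) :
    IsPointwiseSum (fun n => g ∘ₗ f n) (g ∘ₗ F) := fun x => by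
  refine ⟨(hF x).1.subset fun n hn hn' => hn ?_, ?_⟩
  · simp only [LinearMap.comp_apply, hn', map_zero]
  · rw [LinearMap.comp_apply, (hF x).2]
    exact map_finsum g (hF x).1

theorem IsPointwiseSum.hasDegree {𝓜 : ℤ → Submodule K M} {𝓝 : ℤ → Submodule K N} {e : ℤ}
    {f : ℕ → M →ₗ[K] N} {F : M →ₗ[K] N} (hF : IsPointwiseSum f F)
    (hf : ∀ n, HasDegree 𝓜 𝓝 e (f n)) : HasDegree 𝓜 𝓝 e F := fun i x hx => by
  rw [(hF x).2]
  exact finsum_induction (· ∈ 𝓝 (i + e)) (Submodule.zero_mem _)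
    (fun _ _ => Submodule.add_mem _) fun n => hf n i x hx

theorem HasDegree.pow {𝓝 : ℤ → Submodule K N} {u : N →ₗ[K] N} (hu : HasDegree 𝓝 𝓝 0 u) (n : ℕ) :
    HasDegree 𝓝 𝓝 0 (u ^ n) := by
  induction n with
  | zero => exact fun i x hx => by simpa using hx
  | succ n ih =>
    rw [pow_succ]
    have := HasDegree.comp ih hu
    rw [add_zero] at this
    exact this

/-- The geometric series of a locally nilpotent operator. -/
theorem exists_isPointwiseSum_pow {u : N →ₗ[K] N} (hu : ∀ x, ∃ n, (u ^ n) x = 0)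
    (I : M →ₗ[K] N) :
    ∃ F, IsPointwiseSum (fun n => (u ^ n) ∘ₗ I) F ∧ ∀ x, F x = I x + u (F x) := by
  have hz : ∀ x n, (u ^ n) (I x) = 0 → ∀ m, n ≤ m → (u ^ m) (I x) = 0 := fun x n hn m hm => by
    rw [← Nat.sub_add_cancel hm, pow_add, Module.End.mul_apply, hn, map_zero]
  have hsupp : ∀ x n, (u ^ n) (I x) = 0 →
      (Function.support fun n => ((u ^ n) ∘ₗ I) x) ⊆ Finset.range n := fun x n hn m hm => by
    by_contra h
    exact hm (hz x n hn m (by simpa using h))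
  obtain ⟨F, hF⟩ := exists_isPointwiseSum (f := fun n => (u ^ n) ∘ₗ I) fun x => by
    obtain ⟨n, hn⟩ := hu (I x)
    exact (Finset.finite_toSet _).subset (hsupp x n hn)
  refine ⟨F, hF, fun x => ?_⟩
  obtain ⟨n, hn⟩ := hu (I x)
  have h1 : F x = ∑ m ∈ Finset.range n, (u ^ m) (I x) := by
    rw [(hF x).2]
    exact finsum_eq_sum_of_support_subset _ (hsupp x n hn)
  -- Including one more term, which vanishes, makes the sum after removal of the zeroth term equal
  -- to `u` applied to `h1`.
  have h2 : F x = ∑ m ∈ Finset.range (n + 1), (u ^ m) (I x) := by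
    rw [Finset.sum_range_succ, hn, add_zero, h1]
  conv_lhs => rw [h2, Finset.sum_range_succ']
  rw [h1, map_sum, add_comm]
  congr 1
  refine Finset.sum_congr rfl fun m _ => ?_
  rw [pow_succ', Module.End.mul_apply]

/-- Uniqueness of solutions of `F = I + u F`: the difference of two solutions is fixed by `u`. -/
theorem eq_zero_of_apply_eq_self {u : N →ₗ[K] N} {x : N} (hn : ∃ n, (u ^ n) x = 0)
    (hx : u x = x) : x = 0 := by
  obtain ⟨n, hn⟩ := hn
  induction n with
  | zero => simpa using hn
  | succ n ih =>
    rw [pow_succ, Module.End.mul_apply, hx] at hn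
    exact ih hn

/-- The perturbed inclusion intertwines the differentials on the vectors whose image is annihilated
by the square of the perturbed differential. -/
theorem IsContraction.perturbation_comm {𝓜 : ℤ → Submodule K M} {dM : M →ₗ[K] M}
    {𝓝 : ℤ → Submodule K N} {d : N →ₗ[K] N} {I : M →ₗ[K] N} {P : N →ₗ[K] M} {h : N →ₗ[K] N}
    (hC : IsContraction 𝓜 dM 𝓝 d I P h) {δ : N →ₗ[K] N}
    (hu : ∀ x, ∃ n, ((h ∘ₗ δ) ^ n) x = 0) {F : M →ₗ[K] N}
    (hF : ∀ x, F x = I x + (h ∘ₗ δ) (F x)) {x : M}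
    (hx : (d + δ) ((d + δ) (F x)) = 0) : (d + δ) (F x) = F (dM x + P (δ (F x))) := by
  rw [← sub_eq_zero]
  -- The defect `E = (d + δ) F x - F (dM x + P δ F x)` satisfies `h δ E = E`: expand both
  -- occurrences of `F` by its fixed-point equation, replace `I P - 1` by `d h + h d`, and trade `h
  -- d δ F x` for `-h δ (d + δ) F x`.
  refine eq_zero_of_apply_eq_self (hu _) ?_
  have h1 : d (I x) = I (dM x) := LinearMap.congr_fun hC.ι_comm x
  have h2 := LinearMap.congr_fun hC.homotopy (δ (F x))
  have h3 : ∀ y, d (d y) = 0 := LinearMap.congr_fun hC.dN_sq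
  have h4 := hF (dM x + P (δ (F x)))
  have h5 := congrArg d (hF x)
  simp only [LinearMap.add_apply, LinearMap.sub_apply, LinearMap.comp_apply, LinearMap.id_apply,
    map_add, h3, zero_add] at *
  -- The vanishing of the squared differential enters here, at the single vector `F x`.
  have h6 := congrArg h hx
  simp only [map_add, map_zero] at h6
  rw [h1] at h5
  simp only [map_sub, map_add]
  linear_combination (norm := abel) h6 - h5 + h4 + h2

end Perturbation

/-! ### Perturbation of contractions of tensor coalgebras. -/

section PerturbationTensor

variable {K : Type*} [Field K] {V : Type*} [AddCommGroup V] [Module K V]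
  {W : Type*} [AddCommGroup W] [Module K W]

theorem mem_tFilt_of_lof {δ : TBar K V →ₗ[K] TBar K W}
    (hδ : ∀ n t, δ (DirectSum.lof K ℕ (fun n => ⨂[K]^(n + 1) V) n t) ∈ tFilt (K := K) (V := W) n)
    {n : ℕ} {x : TBar K V} (hx : x ∈ tFilt (K := K) (V := V) (n + 1)) :
    δ x ∈ tFilt (K := K) (V := W) n :=
  Submodule.mem_comap.1 (mem_of_mem_tFilt hx (Submodule.comap δ (tFilt n)) fun m hm t =>
    tFilt_mono (by omega) (hδ m t))

theorem pow_eq_zero_of_lowers {u : TBar K V →ₗ[K] TBar K V}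
    (hu : ∀ n, ∀ x ∈ tFilt (K := K) (V := V) (n + 1), u x ∈ tFilt (K := K) (V := V) n)
    (x : TBar K V) : ∃ n, (u ^ n) x = 0 := by
  obtain ⟨n, hn⟩ := exists_mem_tFilt x
  refine ⟨n, ?_⟩
  induction n generalizing x with
  | zero => simpa using mem_tFilt_zero.1 hn
  | succ n ih =>
    rw [pow_succ, Module.End.mul_apply]
    exact ih _ (hu n x hn)

/-- Each of the four terms applies `δ` to exactly one factor, and the other maps do not raise
length; the sum of the two length bounds therefore drops by one at every application. -/
theorem pow_eq_zero_of_lowers_tensor {H : TBar K V ⊗[K] TBar K V →ₗ[K] TBar K V ⊗[K] TBar K V}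
    {f g ε δ : TBar K V →ₗ[K] TBar K V}
    (hH : ∀ x y, H (x ⊗ₜ[K] y) = f (δ x) ⊗ₜ[K] g y + g (δ x) ⊗ₜ[K] y +
      (f (ε x) ⊗ₜ[K] g (δ y) + g (ε x) ⊗ₜ[K] δ y))
    (hf : ∀ n, ∀ x ∈ tFilt (K := K) (V := V) n, f x ∈ tFilt (K := K) (V := V) n)
    (hg : ∀ n, ∀ x ∈ tFilt (K := K) (V := V) n, g x ∈ tFilt (K := K) (V := V) n)
    (hε : ∀ n, ∀ x ∈ tFilt (K := K) (V := V) n, ε x ∈ tFilt (K := K) (V := V) n)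
    (hδ : ∀ n, ∀ x ∈ tFilt (K := K) (V := V) (n + 1), δ x ∈ tFilt (K := K) (V := V) n)
    (z : TBar K V ⊗[K] TBar K V) : ∃ n, (H ^ n) z = 0 := by
  have key : ∀ (n a b : ℕ), a + b ≤ n → ∀ x ∈ tFilt (K := K) (V := V) a,
      ∀ y ∈ tFilt (K := K) (V := V) b, (H ^ n) (x ⊗ₜ[K] y) = 0 := by
    intro n
    induction n with
    | zero =>
      intro a b hab x hx y hy
      obtain rfl : a = 0 := by omega
      rw [mem_tFilt_zero.1 hx, TensorProduct.zero_tmul, map_zero]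
    | succ n ih =>
      intro a b hab x hx y hy
      obtain _ | a := a
      · rw [mem_tFilt_zero.1 hx, TensorProduct.zero_tmul, map_zero]
      obtain _ | b := b
      · rw [mem_tFilt_zero.1 hy, TensorProduct.tmul_zero, map_zero]
      rw [pow_succ, Module.End.mul_apply, hH, map_add, map_add, map_add,
        ih a (b + 1) (by omega) _ (hf _ _ (hδ _ _ hx)) _ (hg _ _ hy),
        ih a (b + 1) (by omega) _ (hg _ _ (hδ _ _ hx)) _ hy,
        ih (a + 1) b (by omega) _ (hf _ _ (hε _ _ hx)) _ (hg _ _ (hδ _ _ hy)),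
        ih (a + 1) b (by omega) _ (hg _ _ (hε _ _ hx)) _ (hδ _ _ hy), add_zero, add_zero]
  induction z using TensorProduct.induction_on with
  | zero => exact ⟨0, map_zero _⟩
  | tmul x y =>
    obtain ⟨a, ha⟩ := exists_mem_tFilt x
    obtain ⟨b, hb⟩ := exists_mem_tFilt y
    exact ⟨a + b, key _ a b le_rfl x ha y hb⟩
  | add x y hx hy =>
    obtain ⟨a, ha⟩ := hx
    obtain ⟨b, hb⟩ := hy
    refine ⟨a + b, ?_⟩
    rw [map_add, pow_add, Module.End.mul_apply, Module.End.mul_apply, hb, map_zero, add_zero,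
      ← Module.End.mul_apply, ← pow_add, add_comm, pow_add, Module.End.mul_apply, ha, map_zero]

variable {𝓥 : ℤ → Submodule K V} [DirectSum.Decomposition 𝓥]
  {𝓦 : ℤ → Submodule K W} [DirectSum.Decomposition 𝓦]

/-- The perturbed inclusion of a coalgebra contraction of tensor coalgebras is a morphism of graded
coalgebras, and the perturbation of the differential is a coderivation. -/
theorem IsCoalgebraContraction.perturbation {dW : TBar K W →ₗ[K] TBar K W}
    {d h δ : TBar K V →ₗ[K] TBar K V} {I : TBar K W →ₗ[K] TBar K V} {P : TBar K V →ₗ[K] TBar K W}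
    (hC : IsCoalgebraContraction (tGrading 𝓦) (tSign 𝓦) deconcat dW (tGrading 𝓥) (tSign 𝓥) deconcat
      d I P h)
    (hδ : IsCoderivation (tGrading 𝓥) (tSign 𝓥) deconcat δ)
    (hIP : ∀ n, ∀ x ∈ tFilt (K := K) (V := V) n, I (P x) ∈ tFilt (K := K) (V := V) n)
    (hh : ∀ n, ∀ x ∈ tFilt (K := K) (V := V) n, h x ∈ tFilt (K := K) (V := V) n)
    (hlow : ∀ n, ∀ x ∈ tFilt (K := K) (V := V) (n + 1), δ x ∈ tFilt (K := K) (V := V) n)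
    {F : TBar K W →ₗ[K] TBar K V} (hsum : IsPointwiseSum (fun n => ((h ∘ₗ δ) ^ n) ∘ₗ I) F)
    (hF : ∀ x, F x = I x + (h ∘ₗ δ) (F x)) :
    IsCoalgebraHom (tGrading 𝓦) deconcat (tGrading 𝓥) deconcat F ∧
      IsCoderivation (tGrading 𝓦) (tSign 𝓦) deconcat (P ∘ₗ δ ∘ₗ F) ∧ ∀ x, P (F x) = x := by
  have hu : HasDegree (tGrading 𝓥) (tGrading 𝓥) 0 (h ∘ₗ δ) := by
    simpa using HasDegree.comp hC.degree_h hδ.degree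
  have hdeg : HasDegree (tGrading 𝓦) (tGrading 𝓥) 0 F := hsum.hasDegree fun n => by
    simpa using (hu.pow n).comp hC.degree_ι
  have sP := tSign_comp_even 𝓥 𝓦 hC.degree_π
  have sF := tSign_comp_even 𝓦 𝓥 hdeg
  have cδ := hδ.comul_apply
  have cI : ∀ x, deconcat (I x) = TensorProduct.map I I (deconcat x) :=
    LinearMap.congr_fun hC.hom_ι.comul
  have cP : ∀ x, deconcat (P x) = TensorProduct.map P P (deconcat x) :=
    LinearMap.congr_fun hC.hom_π.comul
  have ch : ∀ x, deconcat (h x) =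
      (TensorProduct.map (I ∘ₗ P ∘ₗ tSign 𝓥) h + TensorProduct.map h LinearMap.id :
        TBar K V ⊗[K] TBar K V →ₗ[K] TBar K V ⊗[K] TBar K V) (deconcat x) :=
    LinearMap.congr_fun hC.comul_h
  have hPh : ∀ x, P (h x) = 0 := LinearMap.congr_fun hC.π_h
  have hhI : ∀ x, h (I x) = 0 := LinearMap.congr_fun hC.h_ι
  have hhh : ∀ x, h (h x) = 0 := LinearMap.congr_fun hC.h_h
  have hPI : ∀ x, P (I x) = x := LinearMap.congr_fun hC.π_ι
  have hhF : ∀ x, h (F x) = 0 := fun x => by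
    rw [hF, map_add, hhI, zero_add, LinearMap.comp_apply, hhh]
  have hPF : ∀ x, P (F x) = x := fun x => by
    rw [hF, map_add, hPI, LinearMap.comp_apply, hPh, add_zero]
  have hε : ∀ n, ∀ x ∈ tFilt (K := K) (V := V) n, tSign 𝓥 x ∈ tFilt (K := K) (V := V) n :=
    fun n x hx => tMap_mem_tFilt _ hx
  -- This is `h δ` transported through the coproduct: `deconcat ∘ h ∘ δ = H ∘ deconcat`.
  set H : TBar K V ⊗[K] TBar K V →ₗ[K] TBar K V ⊗[K] TBar K V :=
    (TensorProduct.map (I ∘ₗ P ∘ₗ tSign 𝓥) h + TensorProduct.map h LinearMap.id) ∘ₗ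
      (TensorProduct.map δ LinearMap.id + TensorProduct.map (tSign 𝓥) δ) with hH
  have hHt : ∀ x y, H (x ⊗ₜ[K] y) =
      (I ∘ₗ P ∘ₗ tSign 𝓥) (δ x) ⊗ₜ[K] h y + h (δ x) ⊗ₜ[K] y +
        ((I ∘ₗ P ∘ₗ tSign 𝓥) (tSign 𝓥 x) ⊗ₜ[K] h (δ y) + h (tSign 𝓥 x) ⊗ₜ[K] δ y) := fun x y => by
    simp only [hH, LinearMap.comp_apply, LinearMap.add_apply, TensorProduct.map_tmul, map_add,
      LinearMap.id_apply]
  have hnil : ∀ z, ∃ n, (H ^ n) z = 0 :=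
    pow_eq_zero_of_lowers_tensor hHt (fun n x hx => hIP _ _ (hε _ _ hx)) hh hε hlow
  -- By `h F = 0` and `P F = 1`, only `h δ F x ⊗ F y + I x ⊗ h δ F y` survives in `H (F x ⊗ F y)`.
  -- Substituting `h δ F = F - I` makes this telescope to `F x ⊗ F y - I x ⊗ I y`.
  have hFF : ∀ z, TensorProduct.map F F z = TensorProduct.map I I z +
      H (TensorProduct.map F F z) := by
    refine LinearMap.congr_fun (g := TensorProduct.map I I + H ∘ₗ TensorProduct.map F F)
      (TensorProduct.ext' fun x y => ?_)
    simp only [LinearMap.add_apply, LinearMap.comp_apply, TensorProduct.map_tmul, hHt, hhF,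
      TensorProduct.tmul_zero, sF, hPF, tSign_tSign, TensorProduct.zero_tmul]
    have hx := hF x
    have hy := hF y
    rw [LinearMap.comp_apply] at hx hy
    have hx' := eq_sub_of_add_eq' hx.symm
    have hy' := eq_sub_of_add_eq' hy.symm
    rw [hx', hy', TensorProduct.sub_tmul, TensorProduct.tmul_sub]
    abel
  have cF : ∀ x, deconcat (F x) = TensorProduct.map F F (deconcat x) := fun x => by
    rw [← sub_eq_zero]
    -- Both sides solve the fixed-point equation of the locally nilpotent `H` with the same
    -- inhomogeneous term.
    refine eq_zero_of_apply_eq_self (hnil _) ?_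
    have h1 : deconcat (F x) = TensorProduct.map I I (deconcat x) + H (deconcat (F x)) := by
      conv_lhs => rw [hF, map_add, cI, LinearMap.comp_apply, ch, cδ]
      rfl
    have h2 := hFF (deconcat x)
    rw [map_sub]
    conv_rhs => rw [h1, h2]
    exact (add_sub_add_left_eq_sub _ _ _).symm
  refine ⟨⟨hdeg, LinearMap.ext cF⟩, ⟨?_, LinearMap.ext fun x => ?_⟩, hPF⟩
  · simpa using HasDegree.comp hC.degree_π (hδ.degree.comp hdeg)
  -- The factors not hit by `δ` become `P F` and `P ε F`, that is, the identity and the sign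
  -- operator of `W`.
  · simp only [LinearMap.comp_apply, cP, cδ, cF]
    refine LinearMap.congr_fun (f := TensorProduct.map P P ∘ₗ
      (TensorProduct.map δ LinearMap.id + TensorProduct.map (tSign 𝓥) δ) ∘ₗ TensorProduct.map F F)
      (TensorProduct.ext' fun x y => ?_) (deconcat x)
    simp only [LinearMap.add_apply, LinearMap.comp_apply, TensorProduct.map_tmul, map_add,
      LinearMap.id_apply, sF, hPF]

end PerturbationTensor

end LInfty

namespace LInfty

/-! ### Graded cocommutativity of the symmetric coalgebra. -/

section Cocommutativity

variable {K : Type*} [Field K] {V : Type*} [AddCommGroup V] [Module K V]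
  {W : Type*} [AddCommGroup W] [Module K W]

/-- The swap `x ⊗ y ↦ (-1)^(deg x deg y) y ⊗ x`, expressed by the sign operators `s` and `t`. -/
def koszulFlip {M N : Type*} [AddCommGroup M] [Module K M] [AddCommGroup N] [Module K N]
    (s : M →ₗ[K] M) (t : N →ₗ[K] N) : M ⊗[K] N →ₗ[K] N ⊗[K] M :=
  (2 : K)⁻¹ • ((TensorProduct.comm K M N).toLinearMap ∘ₗ
    (LinearMap.id + TensorProduct.map s LinearMap.id + TensorProduct.map LinearMap.id t +
      TensorProduct.map (-s) t))

/-- For signs `s, t = ±1` the number `(1 + s + t - s t) / 2` is `-1` exactly when both are `-1`;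
this expresses the Koszul sign linearly, without choosing homogeneous elements. -/
theorem koszulFlip_tmul {M N : Type*} [AddCommGroup M] [Module K M] [AddCommGroup N] [Module K N]
    (s : M →ₗ[K] M) (t : N →ₗ[K] N) (x : M) (y : N) :
    koszulFlip s t (x ⊗ₜ[K] y) =
      (2 : K)⁻¹ • (y ⊗ₜ[K] x + y ⊗ₜ[K] s x + t y ⊗ₜ[K] x - t y ⊗ₜ[K] s x) := by
  simp [koszulFlip, TensorProduct.tmul_neg, sub_eq_add_neg]

theorem koszulFlip_map {M N M' N' : Type*} [AddCommGroup M] [Module K M] [AddCommGroup N]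
    [Module K N] [AddCommGroup M'] [Module K M'] [AddCommGroup N'] [Module K N']
    {s : M →ₗ[K] M} {t : N →ₗ[K] N} {s' : M' →ₗ[K] M'} {t' : N' →ₗ[K] N'} {f : M →ₗ[K] M'}
    {g : N →ₗ[K] N'} (hf : ∀ x, s' (f x) = f (s x)) (hg : ∀ x, t' (g x) = g (t x))
    (z : M ⊗[K] N) :
    koszulFlip s' t' (TensorProduct.map f g z) = TensorProduct.map g f (koszulFlip s t z) := by
  refine LinearMap.congr_fun (f := koszulFlip s' t' ∘ₗ TensorProduct.map f g)
    (g := TensorProduct.map g f ∘ₗ koszulFlip s t) (TensorProduct.ext' fun x y => ?_) z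
  simp only [LinearMap.comp_apply, TensorProduct.map_tmul, koszulFlip_tmul, map_smul, map_sub,
    map_add, hf, hg]

/-- The flip interchanges the summands `Q ⊗ 1` and `s ⊗ Q`; the anticommutation of `Q` with `s`
supplies the sign. -/
theorem koszulFlip_coderivation {M : Type*} [AddCommGroup M] [Module K M] {s Q : M →ₗ[K] M}
    (hs : ∀ x, s (s x) = x) (hQ : ∀ x, s (Q x) = -Q (s x)) (z : M ⊗[K] M) :
    koszulFlip s s ((TensorProduct.map Q LinearMap.id + TensorProduct.map s Q :
        M ⊗[K] M →ₗ[K] M ⊗[K] M) z) =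
      (TensorProduct.map Q LinearMap.id + TensorProduct.map s Q : M ⊗[K] M →ₗ[K] M ⊗[K] M)
        (koszulFlip s s z) := by
  refine LinearMap.congr_fun (f := koszulFlip s s ∘ₗ
      (TensorProduct.map Q LinearMap.id + TensorProduct.map s Q))
    (g := (TensorProduct.map Q LinearMap.id + TensorProduct.map s Q) ∘ₗ koszulFlip s s)
    (TensorProduct.ext' fun a b => ?_) z
  simp only [LinearMap.comp_apply, LinearMap.add_apply, TensorProduct.map_tmul, map_add, map_sub,
    map_smul, koszulFlip_tmul, LinearMap.id_apply, hs, hQ, TensorProduct.tmul_neg,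
    TensorProduct.neg_tmul]
  rw [← smul_add]
  congr 1
  abel

/-- The permutation of `{1, …, p + q}` that exchanges the first `p` with the last `q` elements. -/
def blockFlip {N p q : ℕ} (h : N = p + q) (h' : N = q + p) : Equiv.Perm (Fin N) :=
  (finCongr h).trans (finAddFlip.trans (finCongr h'.symm))

theorem blockFlip_castAdd {p q : ℕ} (h' : p + q = q + p) (i : Fin p) :
    blockFlip rfl h' (Fin.castAdd q i) = (Fin.natAdd q i).cast h'.symm := by
  simp [blockFlip]

theorem blockFlip_natAdd {p q : ℕ} (h' : p + q = q + p) (j : Fin q) :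
    blockFlip rfl h' (Fin.natAdd p j) = (Fin.castAdd p j).cast h'.symm := by
  simp [blockFlip]

/-- The inversions of the block exchange are exactly the pairs with one entry in each block. -/
theorem koszulSign_blockFlip {p q : ℕ} (h' : p + q = q + p) (a : Fin (p + q) → ZMod 2) :
    koszulSign (blockFlip rfl h') a = ∏ i : Fin p, ∏ j : Fin q,
      if a (Fin.castAdd q i) = 1 ∧ a (Fin.natAdd p j) = 1 then -1 else 1 := by
  rw [koszulSign_eq, Fin.prod_univ_add]
  simp only [Fin.prod_univ_add, blockFlip_castAdd, blockFlip_natAdd, Fin.lt_def, Fin.val_cast,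
    Fin.val_castAdd, Fin.val_natAdd]
  refine (congrArg₂ (· * ·) (Finset.prod_congr rfl fun i _ => (congrArg₂ (· * ·)
    (Finset.prod_eq_one fun i' _ => ?_) (Finset.prod_congr rfl fun j _ => ?_)).trans (one_mul _))
    (Finset.prod_eq_one fun j _ => (congrArg₂ (· * ·) (Finset.prod_eq_one fun i _ => ?_)
      (Finset.prod_eq_one fun j' _ => ?_)).trans (one_mul 1))).trans (mul_one _)
  · split_ifs <;> first | rfl | omega
  · have h1 : (i : ℕ) < p + j := by omega
    have h2 : (j : ℕ) < q + i := by omega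
    simp only [h1, h2, if_true, true_and]
  · split_ifs <;> first | rfl | omega
  · split_ifs <;> first | rfl | omega

/-- Matches the pairwise Koszul sign of two blocks with the formula of `koszulFlip` in terms of the
total sign of each block. -/
theorem two_mul_prod_sign {p q : ℕ} (a : Fin p → ZMod 2) (b : Fin q → ZMod 2) :
    2 * (∏ i, ∏ j, if a i = 1 ∧ b j = 1 then (-1 : ℤ) else 1) =
      1 + (∏ i, if a i = 1 then -1 else 1) + (∏ j, if b j = 1 then -1 else 1) -
        (∏ i, if a i = 1 then -1 else 1) * ∏ j, if b j = 1 then -1 else 1 := by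
  have hin : ∀ i, (∏ j, if a i = 1 ∧ b j = 1 then (-1 : ℤ) else 1) =
      if a i = 1 then ∏ j, if b j = 1 then -1 else 1 else 1 := fun i => by
    by_cases h : a i = 1 <;> simp [h]
  simp only [hin]
  have hB : (∏ j, if b j = 1 then (-1 : ℤ) else 1) = 1 ∨
      (∏ j, if b j = 1 then (-1 : ℤ) else 1) = -1 := by
    refine Finset.prod_induction _ (fun x : ℤ => x = 1 ∨ x = -1) ?_ (Or.inl rfl) fun j _ => ?_
    · rintro x y (rfl | rfl) (rfl | rfl) <;> simp
    · split_ifs <;> simp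
  rcases hB with hB | hB <;> simp only [hB, ite_self, Finset.prod_const_one] <;> ring

variable (𝓥 : ℤ → Submodule K V) [DirectSum.Decomposition 𝓥]

theorem signOp_of_parity {a : ZMod 2} {v : V}
    (hv : ∀ e, parityProj 𝓥 e v = if a = e then v else 0) :
    signOp 𝓥 v = ((if a = 1 then -1 else 1 : ℤ) : K) • v := by
  rw [signOp, LinearMap.sub_apply, hv, hv]
  have ha : ∀ a : ZMod 2, a = 0 ∨ a = 1 := by decide
  rcases ha a with rfl | rfl <;> simp

theorem map_signOp_of_parity {n : ℕ} {a : Fin n → ZMod 2} {v : Fin n → V}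
    (hv : ∀ i e, parityProj 𝓥 e (v i) = if a i = e then v i else 0) :
    PiTensorProduct.map (fun _ => signOp 𝓥) (PiTensorProduct.tprod K v) =
      ((∏ i, if a i = 1 then -1 else 1 : ℤ) : K) • PiTensorProduct.tprod K v := by
  rw [PiTensorProduct.map_tprod]
  simp only [fun i => signOp_of_parity 𝓥 (hv i)]
  rw [MultilinearMap.map_smul_univ, Int.cast_prod]

theorem splitAt_koszulAction_blockFlip [CharZero K] {N p q : ℕ} (h : N = p + q) (h' : N = q + p)
    (x : ⨂[K]^N V) :
    splitAt h' (koszulAction 𝓥 (blockFlip h h') x) =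
      koszulFlip (PiTensorProduct.map fun _ => signOp 𝓥) (PiTensorProduct.map fun _ => signOp 𝓥)
        (splitAt h x) := by
  subst h
  refine LinearMap.congr_fun (f := splitAt h' ∘ₗ koszulAction 𝓥 (blockFlip rfl h'))
    (g := koszulFlip _ _ ∘ₗ splitAt rfl) (ext_parity 𝓥 fun a v hv => ?_) x
  have e1 : ∀ j : Fin q, (blockFlip rfl h').symm ((Fin.castAdd p j).cast h'.symm) =
      Fin.natAdd p j := fun j => by
    rw [Equiv.symm_apply_eq, blockFlip_natAdd]
  have e2 : ∀ i : Fin p, (blockFlip rfl h').symm ((Fin.natAdd q i).cast h'.symm) =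
      Fin.castAdd q i := fun i => by
    rw [Equiv.symm_apply_eq, blockFlip_castAdd]
  rw [LinearMap.comp_apply, LinearMap.comp_apply, koszulAction_tprod_parity 𝓥 _ a v hv, map_smul,
    splitAt_tprod, splitAt_tprod, koszulFlip_tmul]
  simp only [e1, e2, Fin.cast_eq_self]
  rw [map_signOp_of_parity 𝓥 fun i e => hv (Fin.castAdd q i) e,
    map_signOp_of_parity 𝓥 fun j e => hv (Fin.natAdd p j) e, koszulSign_blockFlip]
  have h2 := congrArg (Int.cast : ℤ → K)
    (two_mul_prod_sign (fun i => a (Fin.castAdd q i)) fun j => a (Fin.natAdd p j))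
  generalize (∏ i : Fin p, ∏ j : Fin q,
    if a (Fin.castAdd q i) = 1 ∧ a (Fin.natAdd p j) = 1 then (-1 : ℤ) else 1) = c at h2 ⊢
  generalize (∏ i : Fin p, if a (Fin.castAdd q i) = 1 then (-1 : ℤ) else 1) = A at h2 ⊢
  generalize (∏ j : Fin q, if a (Fin.natAdd p j) = 1 then (-1 : ℤ) else 1) = B at h2 ⊢
  rw [eq_inv_smul_iff₀ two_ne_zero, smul_smul]
  push_cast at h2
  rw [h2]
  simp only [TensorProduct.tmul_smul, ← TensorProduct.smul_tmul']
  module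

theorem splitTerm_congr {N p q p' q' : ℕ} (hp : p = p') (hq : q = q')
    (h : N + 1 = (p + 1) + (q + 1)) (h' : N + 1 = (p' + 1) + (q' + 1)) (t : ⨂[K]^(N + 1) V) :
    splitTerm h t = splitTerm h' t := by
  subst hp hq
  rfl

/-- The coproduct of `S̄(V)` is graded cocommutative. -/
theorem koszulFlip_deconcat [CharZero K] {x : TBar K V} (hx : x ∈ SBar 𝓥) :
    koszulFlip (tSign 𝓥) (tSign 𝓥) (deconcat x) = deconcat x := by
  classical
  rw [mem_SBar] at hx
  rw [← DirectSum.sum_support_of x]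
  simp only [map_sum]
  refine Finset.sum_congr rfl fun n _ => ?_
  change koszulFlip _ _ (deconcat (DirectSum.lof K ℕ (fun n => ⨂[K]^(n + 1) V) n (x n))) =
    deconcat (DirectSum.lof K ℕ (fun n => ⨂[K]^(n + 1) V) n (x n))
  rw [deconcat_lof, map_sum]
  -- The flip sends each cut to the one with the two lengths exchanged; the summands agree because
  -- `x n` is invariant under the block exchange.
  refine Fintype.sum_equiv Fin.revPerm _ _ fun i => ?_
  have h : n + 1 = ((i : ℕ) + 1) + (n - (i + 1) + 1) := by omega
  have h' : n + 1 = (n - (i + 1) + 1) + ((i : ℕ) + 1) := by omega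
  refine Eq.trans ?_ (splitTerm_congr (p := n - (i + 1)) (q := i) ?_ ?_ h' _ _)
  · rw [splitTerm, splitTerm, LinearMap.comp_apply,
      LinearMap.comp_apply, koszulFlip_map (s := PiTensorProduct.map fun _ => signOp 𝓥)
        (t := PiTensorProduct.map fun _ => signOp 𝓥) (fun x => tMap_lof _ _ _)
        (fun x => tMap_lof _ _ _), ← splitAt_koszulAction_blockFlip 𝓥 h h',
      (mem_symPower 𝓥).1 (hx n)]
  · simp [Fin.val_rev]
  · simp only [Fin.revPerm_apply, Fin.val_rev]
    omega

end Cocommutativity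

/-! ### Detecting symmetric tensors by the coproduct, and restriction to `SBar`. -/

section SymmetricTensors

variable {K : Type*} [Field K] {V : Type*} [AddCommGroup V] [Module K V]
  (𝓥 : ℤ → Submodule K V) [DirectSum.Decomposition 𝓥]

/-- Unlike in `map_koszulAction_splitAt`, the tensor is arbitrary, so the formula can serve to prove
invariance. Describing `ρ` by its values allows adjacent transpositions to be used directly. -/
theorem splitAt_koszulAction {N p q : ℕ} (h : N = p + q) {ρ : Equiv.Perm (Fin N)}
    {σ : Equiv.Perm (Fin p)} {τ : Equiv.Perm (Fin q)}
    (h1 : ∀ i, ρ ((Fin.castAdd q i).cast h.symm) = (Fin.castAdd q (σ i)).cast h.symm)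
    (h2 : ∀ j, ρ ((Fin.natAdd p j).cast h.symm) = (Fin.natAdd p (τ j)).cast h.symm)
    (x : ⨂[K]^N V) :
    splitAt h (koszulAction 𝓥 ρ x) =
      TensorProduct.map (koszulAction 𝓥 σ) (koszulAction 𝓥 τ) (splitAt h x) := by
  subst h
  obtain rfl : ρ = blockPerm σ τ := Equiv.ext fun i => by
    refine Fin.addCases (fun i => ?_) (fun i => ?_) i
    · simpa [blockPerm_castAdd] using h1 i
    · simpa [blockPerm_natAdd] using h2 i
  refine LinearMap.congr_fun
    (f := splitAt rfl ∘ₗ koszulAction 𝓥 (blockPerm σ τ))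
    (g := TensorProduct.map (koszulAction 𝓥 σ) (koszulAction 𝓥 τ) ∘ₗ splitAt rfl)
    (ext_parity 𝓥 fun a v hv => ?_) x
  have e1 : ∀ i, (blockPerm σ τ).symm (Fin.castAdd q i) = Fin.castAdd q (σ.symm i) := fun i => by
    rw [Equiv.symm_apply_eq, blockPerm_castAdd, Equiv.apply_symm_apply]
  have e2 : ∀ i, (blockPerm σ τ).symm (Fin.natAdd p i) = Fin.natAdd p (τ.symm i) := fun i => by
    rw [Equiv.symm_apply_eq, blockPerm_natAdd, Equiv.apply_symm_apply]
  rw [LinearMap.comp_apply, LinearMap.comp_apply, splitAt_tprod, TensorProduct.map_tmul,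
    koszulAction_tprod_parity 𝓥 _ a v hv, map_smul, splitAt_tprod]
  simp only [Fin.cast_eq_self, e1, e2]
  rw [koszulAction_tprod_parity 𝓥 σ (fun i => a (Fin.castAdd q i)) _ fun i e => hv _ e,
    koszulAction_tprod_parity 𝓥 τ (fun i => a (Fin.natAdd p i)) _ fun i e => hv _ e,
    koszulSign_blockPerm, TensorProduct.smul_tmul_smul, Int.cast_mul]

/-- Adjacent transpositions generate the symmetric group, and the Koszul action is multiplicative.
-/
theorem mem_symPower_of_swap {n : ℕ} {x : ⨂[K]^(n + 1) V}
    (h : ∀ i : Fin n, koszulAction 𝓥 (Equiv.swap i.castSucc i.succ) x = x) :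
    x ∈ symPower 𝓥 (n + 1) := by
  rw [mem_symPower]
  intro σ
  have hσ : σ ∈ Submonoid.closure
      (Set.range fun i : Fin n => Equiv.swap i.castSucc i.succ) := by
    rw [Equiv.Perm.mclosure_swap_castSucc_succ]
    trivial
  induction hσ using Submonoid.closure_induction with
  | mem σ hσ =>
    obtain ⟨i, rfl⟩ := hσ
    exact h i
  | one => rw [koszulAction_one, LinearMap.id_apply]
  | mul σ τ _ _ hσ hτ => rw [koszulAction_mul, LinearMap.comp_apply, hτ, hσ]

theorem val_swap {n : ℕ} (a b x : Fin n) :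
    (Equiv.swap a b x : ℕ) =
      if (x : ℕ) = a then (b : ℕ) else if (x : ℕ) = b then (a : ℕ) else x := by
  simp only [Equiv.swap_apply_def, Fin.ext_iff]
  split_ifs <;> rfl

/-- With at least three factors, every adjacent transposition fixes the first or the last position.
The first one acts inside the left block of `h2`, all others inside the right block of `h1`. -/
theorem mem_symPower_of_splitAt {m : ℕ} {x : ⨂[K]^(m + 3) V} (h1 : m + 3 = 1 + (m + 2))
    (h2 : m + 3 = (m + 2) + 1)
    (hx1 : ∀ τ, TensorProduct.map LinearMap.id (koszulAction 𝓥 τ) (splitAt h1 x) = splitAt h1 x)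
    (hx2 : ∀ σ, TensorProduct.map (koszulAction 𝓥 σ) LinearMap.id (splitAt h2 x) =
      splitAt h2 x) : x ∈ symPower 𝓥 (m + 3) := by
  refine mem_symPower_of_swap 𝓥 fun i => ?_
  refine Fin.cases ?_ (fun i => ?_) i
  · refine splitAt_injective h2 ?_
    rw [splitAt_koszulAction 𝓥 h2 (σ := Equiv.swap 0 1) (τ := 1), koszulAction_one, hx2]
    · intro j
      simp only [Fin.ext_iff, val_swap, Fin.val_cast, Fin.val_castAdd, Fin.val_castSucc, Fin.val_succ,
        Fin.val_zero, Fin.val_one]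
      grind
    · intro j
      simp only [Fin.ext_iff, val_swap, Fin.val_cast, Fin.val_natAdd, Fin.val_castSucc, Fin.val_succ,
        Equiv.Perm.one_apply, Fin.val_zero]
      grind
  · refine splitAt_injective h1 ?_
    rw [splitAt_koszulAction 𝓥 h1 (σ := 1) (τ := Equiv.swap i.castSucc i.succ), koszulAction_one,
      hx1]
    · intro j
      simp only [Fin.ext_iff, val_swap, Fin.val_cast, Fin.val_castAdd, Fin.val_castSucc, Fin.val_succ,
        Equiv.Perm.one_apply]
      grind
    · intro j
      simp only [Fin.ext_iff, val_swap, Fin.val_cast, Fin.val_natAdd, Fin.val_castSucc, Fin.val_succ]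
      grind

/-- The elements of `T̄(V)` whose component of index `m` is symmetric. -/
def symComponent (m : ℕ) : Submodule K (TBar K V) :=
  (symPower 𝓥 (m + 1)).comap (DirectSum.component K ℕ (fun n => ⨂[K]^(n + 1) V) m)

theorem SBar_le_symComponent (m : ℕ) : SBar 𝓥 ≤ symComponent 𝓥 m :=
  fun _ hx => (mem_SBar 𝓥).1 hx m

/-- Only the coproduct components that cut off a single factor on the left or on the right are
needed; their long pieces are symmetric by assumption. -/
theorem mem_symPower_of_deconcat {m : ℕ} {y : TBar K V}
    (hy : deconcat y ∈ LinearMap.range (TensorProduct.map (symComponent 𝓥 (m + 1)).subtype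
      (symComponent 𝓥 (m + 1)).subtype)) : y (m + 2) ∈ symPower 𝓥 (m + 3) := by
  obtain ⟨z, hz⟩ := hy
  have h1 : m + 2 + 1 = (0 + 1) + (m + 1 + 1) := by omega
  have h2 : m + 2 + 1 = (m + 1 + 1) + (0 + 1) := by omega
  refine mem_symPower_of_splitAt 𝓥 h1 h2 (fun τ => ?_) fun σ => ?_
  · rw [← map_component_deconcat h1, ← hz]
    refine LinearMap.congr_fun (f := TensorProduct.map _ _ ∘ₗ TensorProduct.map _ _ ∘ₗ
      TensorProduct.map _ _) (g := TensorProduct.map _ _ ∘ₗ TensorProduct.map _ _)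
      (TensorProduct.ext' fun a b => ?_) z
    simp only [LinearMap.comp_apply, TensorProduct.map_tmul, LinearMap.id_apply]
    exact congrArg₂ (· ⊗ₜ[K] ·) rfl ((mem_symPower 𝓥).1 b.2 τ)
  · rw [← map_component_deconcat h2, ← hz]
    refine LinearMap.congr_fun (f := TensorProduct.map _ _ ∘ₗ TensorProduct.map _ _ ∘ₗ
      TensorProduct.map _ _) (g := TensorProduct.map _ _ ∘ₗ TensorProduct.map _ _)
      (TensorProduct.ext' fun a b => ?_) z
    simp only [LinearMap.comp_apply, TensorProduct.map_tmul, LinearMap.id_apply]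
    exact congrArg₂ (· ⊗ₜ[K] ·) ((mem_symPower 𝓥).1 a.2 σ) rfl

theorem mem_symPower_one (x : ⨂[K]^1 V) : x ∈ symPower 𝓥 1 := by
  rw [mem_symPower]
  intro σ
  rw [Subsingleton.elim σ 1, koszulAction_one, LinearMap.id_apply]

/-- In length two the pieces of a cut carry no symmetry information, so cocommutativity is used
instead: the only nontrivial permutation is the flip. -/
theorem mem_symPower_two_of_deconcat [CharZero K] {y : TBar K V}
    (hy : koszulFlip (tSign 𝓥) (tSign 𝓥) (deconcat y) = deconcat y) :
    y 1 ∈ symPower 𝓥 2 := by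
  have h : 1 + 1 = (0 + 1) + (0 + 1) := rfl
  have hρ : koszulAction 𝓥 (blockFlip h h) (y 1) = y 1 := by
    refine splitAt_injective h ?_
    rw [splitAt_koszulAction_blockFlip, ← map_component_deconcat h,
      koszulFlip_map (s := tSign 𝓥) (t := tSign 𝓥), hy]
    · exact fun x => rfl
    · exact fun x => rfl
  rw [mem_symPower]
  intro σ
  have hσ : ∀ σ : Equiv.Perm (Fin 2), σ = 1 ∨ σ = blockFlip (p := 1) (q := 1) rfl rfl := by
    decide
  rcases hσ σ with rfl | rfl
  · rw [koszulAction_one, LinearMap.id_apply]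
  · exact hρ

variable {𝓥} {W : Type*} [AddCommGroup W] [Module K W] {𝓦 : ℤ → Submodule K W}
  [DirectSum.Decomposition 𝓦]

/-- A morphism of reduced tensor coalgebras maps symmetric tensors to symmetric tensors. -/
theorem IsCoalgebraHom.mem_SBar [CharZero K] {F : TBar K W →ₗ[K] TBar K V}
    (hF : IsCoalgebraHom (tGrading 𝓦) deconcat (tGrading 𝓥) deconcat F) {x : TBar K W}
    (hx : x ∈ SBar 𝓦) : F x ∈ SBar 𝓥 := by
  have hc : ∀ x, deconcat (F x) = TensorProduct.map F F (deconcat x) :=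
    LinearMap.congr_fun hF.comul
  rw [LInfty.mem_SBar]
  intro n
  induction n using Nat.twoStepInduction generalizing x with
  | zero => exact mem_symPower_one 𝓥 _
  | one =>
    refine mem_symPower_two_of_deconcat 𝓥 ?_
    rw [hc, koszulFlip_map (tSign_comp_even 𝓦 𝓥 hF.degree) (tSign_comp_even 𝓦 𝓥 hF.degree),
      koszulFlip_deconcat 𝓦 hx]
  | more m _ ih =>
    refine mem_symPower_of_deconcat 𝓥 ?_
    -- The coproduct of `x` lies in `SBar ⊗ SBar`, so by induction both factors have a symmetric
    -- component of index `m + 1` after applying `F`.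
    have hs := LinearMap.congr_fun (subtype_comp_sCoproduct 𝓦) ⟨x, hx⟩
    simp only [LinearMap.comp_apply, Submodule.subtype_apply] at hs
    have hF' : ∀ y : SBar 𝓦, (F ∘ₗ (SBar 𝓦).subtype) y ∈ symComponent 𝓥 (m + 1) :=
      fun y => ih y.2
    refine ⟨TensorProduct.map ((F ∘ₗ (SBar 𝓦).subtype).codRestrict _ hF')
      ((F ∘ₗ (SBar 𝓦).subtype).codRestrict _ hF') (sCoproduct 𝓦 ⟨x, hx⟩), ?_⟩
    rw [hc, ← hs, ← LinearMap.comp_apply, ← TensorProduct.map_comp,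
      LinearMap.subtype_comp_codRestrict, TensorProduct.map_comp, LinearMap.comp_apply]

/-- A coderivation of degree `1` of the reduced tensor coalgebra preserves symmetric tensors. -/
theorem IsCoderivation.mem_SBar [CharZero K] {Q : TBar K V →ₗ[K] TBar K V}
    (hQ : IsCoderivation (tGrading 𝓥) (tSign 𝓥) deconcat Q) {x : TBar K V}
    (hx : x ∈ SBar 𝓥) : Q x ∈ SBar 𝓥 := by
  have hc := hQ.comul_apply
  rw [LInfty.mem_SBar]
  intro n
  induction n using Nat.twoStepInduction generalizing x with
  | zero => exact mem_symPower_one 𝓥 _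
  | one =>
    refine mem_symPower_two_of_deconcat 𝓥 ?_
    rw [hc]
    conv_rhs => rw [← koszulFlip_deconcat 𝓥 hx]
    exact koszulFlip_coderivation (tSign_tSign 𝓥) (tSign_comp_odd 𝓥 𝓥 odd_one hQ.degree) _
  | more m _ ih =>
    refine mem_symPower_of_deconcat 𝓥 ?_
    have hs := LinearMap.congr_fun (subtype_comp_sCoproduct 𝓥) ⟨x, hx⟩
    simp only [LinearMap.comp_apply, Submodule.subtype_apply] at hs
    have h1 : ∀ y : SBar 𝓥, (Q ∘ₗ (SBar 𝓥).subtype) y ∈ symComponent 𝓥 (m + 1) :=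
      fun y => ih y.2
    -- In each Leibniz term one factor is not hit by `Q`; it is symmetric already, also after the
    -- sign operator.
    have h2 : ∀ y : SBar 𝓥, (SBar 𝓥).subtype y ∈ symComponent 𝓥 (m + 1) :=
      fun y => SBar_le_symComponent 𝓥 _ y.2
    have h3 : ∀ y : SBar 𝓥, (tSign 𝓥 ∘ₗ (SBar 𝓥).subtype) y ∈ symComponent 𝓥 (m + 1) :=
      fun y => SBar_le_symComponent 𝓥 _ (tSign_mem_SBar 𝓥 _ y.2)
    refine ⟨TensorProduct.map (LinearMap.codRestrict _ _ h1) (LinearMap.codRestrict _ _ h2)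
      (sCoproduct 𝓥 ⟨x, hx⟩) + TensorProduct.map (LinearMap.codRestrict _ _ h3)
        (LinearMap.codRestrict _ _ h1) (sCoproduct 𝓥 ⟨x, hx⟩), ?_⟩
    rw [hc, ← hs, map_add, LinearMap.add_apply, ← LinearMap.comp_apply (TensorProduct.map _ _),
      ← LinearMap.comp_apply (TensorProduct.map _ _),
      ← LinearMap.comp_apply (TensorProduct.map _ _), ← LinearMap.comp_apply (TensorProduct.map _ _)]
    simp only [← TensorProduct.map_comp, LinearMap.subtype_comp_codRestrict, LinearMap.id_comp]

/-- Vector spaces are flat. Coproduct identities on `SBar` can hence be verified inside `TBar ⊗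
TBar`. -/
theorem tensorProduct_map_subtype_injective {M : Type*} [AddCommGroup M] [Module K M]
    (S : Submodule K M) : Function.Injective (TensorProduct.map S.subtype S.subtype) :=
  TensorProduct.map_injective_of_flat_flat _ _ S.subtype_injective S.subtype_injective

theorem map_subtype_sCoproduct [CharZero K] (x : SBar 𝓥) :
    TensorProduct.map (SBar 𝓥).subtype (SBar 𝓥).subtype (sCoproduct 𝓥 x) = deconcat (x : TBar K V) :=
  LinearMap.congr_fun (subtype_comp_sCoproduct 𝓥) x

theorem IsCoalgebraHom.restrict_SBar [CharZero K] {F : TBar K W →ₗ[K] TBar K V}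
    (hF : IsCoalgebraHom (tGrading 𝓦) deconcat (tGrading 𝓥) deconcat F)
    (hS : ∀ x ∈ SBar 𝓦, F x ∈ SBar 𝓥) :
    IsCoalgebraHom (sGrading 𝓦) (sCoproduct 𝓦) (sGrading 𝓥) (sCoproduct 𝓥) (F.restrict hS) where
  degree i x hx := hF.degree i x hx
  comul := by
    refine LinearMap.ext fun x => tensorProduct_map_subtype_injective (SBar 𝓥) ?_
    rw [LinearMap.comp_apply, map_subtype_sCoproduct]
    have h := LinearMap.congr_fun hF.comul x
    rw [LinearMap.comp_apply, LinearMap.comp_apply, ← map_subtype_sCoproduct] at h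
    refine h.trans (LinearMap.congr_fun (f := TensorProduct.map F F ∘ₗ
      TensorProduct.map (SBar 𝓦).subtype (SBar 𝓦).subtype)
      (g := TensorProduct.map (SBar 𝓥).subtype (SBar 𝓥).subtype ∘ₗ
        TensorProduct.map (F.restrict hS) (F.restrict hS)) (TensorProduct.ext' fun a b => ?_)
      (sCoproduct 𝓦 x))
    rfl

theorem IsCoderivation.restrict_SBar [CharZero K] {Q : TBar K V →ₗ[K] TBar K V}
    (hQ : IsCoderivation (tGrading 𝓥) (tSign 𝓥) deconcat Q)
    (hS : ∀ x ∈ SBar 𝓥, Q x ∈ SBar 𝓥) :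
    IsCoderivation (sGrading 𝓥) (sSign 𝓥) (sCoproduct 𝓥) (Q.restrict hS) where
  degree i x hx := hQ.degree i x hx
  leibniz := by
    refine LinearMap.ext fun x => tensorProduct_map_subtype_injective (SBar 𝓥) ?_
    rw [LinearMap.comp_apply, map_subtype_sCoproduct]
    have h := hQ.comul_apply (x : TBar K V)
    rw [← map_subtype_sCoproduct] at h
    refine h.trans (LinearMap.congr_fun (f := (TensorProduct.map Q LinearMap.id +
      TensorProduct.map (tSign 𝓥) Q) ∘ₗ TensorProduct.map (SBar 𝓥).subtype (SBar 𝓥).subtype)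
      (g := TensorProduct.map (SBar 𝓥).subtype (SBar 𝓥).subtype ∘ₗ
        (TensorProduct.map (Q.restrict hS) LinearMap.id +
          TensorProduct.map (sSign 𝓥) (Q.restrict hS))) (TensorProduct.ext' fun a b => ?_)
      (sCoproduct 𝓥 x))
    simp only [LinearMap.comp_apply, LinearMap.add_apply, TensorProduct.map_tmul, map_add]
    rfl

end SymmetricTensors

end LInfty

/-! ### Assembly of the theorem. -/

namespace LInfty

theorem tProj_tIncl {K : Type*} [Field K] {V : Type*} [AddCommGroup V] [Module K V] (v : V) :
    tProj (tIncl (K := K) v) = v := by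
  simp [tProj, tIncl]

end LInfty

theorem theorem6p1 {K : Type*} [Field K] [CharZero K]
    {V : Type*} [AddCommGroup V] [Module K V]
    (𝓥 : ℤ → Submodule K V) [DirectSum.Decomposition 𝓥]
    {W : Type*} [AddCommGroup W] [Module K W]
    (𝓦 : ℤ → Submodule K W) [DirectSum.Decomposition 𝓦]
    -- a coderivation of degree `+1` of the reduced tensor coalgebra, with square zero on `S̄(V)`
    (Q : TBar K V →ₗ[K] TBar K V)
    (hQ : IsCoderivation (tGrading 𝓥) (tSign 𝓥) deconcat Q)
    (hQS : ∀ x ∈ SBar 𝓥, Q (Q x) = 0)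
    -- a contraction of `(V, d₁)`, `d₁ = Q|_V`, onto `(W, dW)`
    (dW : W →ₗ[K] W) (ι : W →ₗ[K] V) (π : V →ₗ[K] W) (k : V →ₗ[K] V)
    (hk : IsContraction 𝓦 dW 𝓥 (linearPart Q) ι π k)
    -- the decomposition `Q = d + δ` and the differential of `T̄(W)`
    (d δ : TBar K V →ₗ[K] TBar K V) (dTW : TBar K W →ₗ[K] TBar K W)
    (hd : d = tDiff 𝓥 (linearPart Q)) (hδ : δ = Q - d) (hdTW : dTW = tDiff 𝓦 dW)
    -- the homotopy `h = Tk`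
    (h : TBar K V →ₗ[K] TBar K V) (hh : h = tHomotopy 𝓥 ι π k) :
    -- `d` preserves and `δ` lowers the length of tensors
    (∀ (n : ℕ) (t : ⨂[K]^(n + 1) V),
      ∃ t' : ⨂[K]^(n + 1) V, d (DirectSum.lof K ℕ (fun n => ⨂[K]^(n + 1) V) n t) =
        DirectSum.lof K ℕ (fun n => ⨂[K]^(n + 1) V) n t') ∧
    (∀ (n : ℕ) (t : ⨂[K]^(n + 1) V) (m : ℕ), n ≤ m →
      δ (DirectSum.lof K ℕ (fun n => ⨂[K]^(n + 1) V) n t) m = 0) ∧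
    -- the tensor power of the contraction is a coalgebra contraction
    IsCoalgebraContraction (tGrading 𝓦) (tSign 𝓦) deconcat dTW
      (tGrading 𝓥) (tSign 𝓥) deconcat d (tMap ι) (tMap π) h ∧
    -- the perturbed inclusion and the perturbation of the differential
    ∃ (ιδ : TBar K W →ₗ[K] TBar K V) (Dδ : TBar K W →ₗ[K] TBar K W),
      IsPointwiseSum (fun n => ((h ∘ₗ δ) ^ n) ∘ₗ tMap ι) ιδ ∧
      IsPointwiseSum (fun n => tMap π ∘ₗ δ ∘ₗ ((h ∘ₗ δ) ^ n) ∘ₗ tMap ι) Dδ ∧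
      IsPointwiseSum (fun n => tMap π ∘ₗ ((δ ∘ₗ h) ^ n) ∘ₗ δ ∘ₗ tMap ι) Dδ ∧
      ∃ (hdV : ∀ x ∈ SBar 𝓥, d x ∈ SBar 𝓥) (hδV : ∀ x ∈ SBar 𝓥, δ x ∈ SBar 𝓥)
        (hdW : ∀ x ∈ SBar 𝓦, dTW x ∈ SBar 𝓦) (hDW : ∀ x ∈ SBar 𝓦, Dδ x ∈ SBar 𝓦)
        (hιδ : ∀ x ∈ SBar 𝓦, ιδ x ∈ SBar 𝓥),
        IsCodifferential (sGrading 𝓥) (sSign 𝓥) (sCoproduct 𝓥)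
          (d.restrict hdV + δ.restrict hδV) ∧
        IsCodifferential (sGrading 𝓦) (sSign 𝓦) (sCoproduct 𝓦)
          (dTW.restrict hdW + Dδ.restrict hDW) ∧
        IsCoalgebraHom (sGrading 𝓦) (sCoproduct 𝓦) (sGrading 𝓥) (sCoproduct 𝓥)
          (ιδ.restrict hιδ) ∧
        (d.restrict hdV + δ.restrict hδV) ∘ₗ ιδ.restrict hιδ =
          ιδ.restrict hιδ ∘ₗ (dTW.restrict hdW + Dδ.restrict hDW) := by
  have hC : IsCoalgebraContraction (tGrading 𝓦) (tSign 𝓦) deconcat dTW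
      (tGrading 𝓥) (tSign 𝓥) deconcat d (tMap ι) (tMap π) h := by
    rw [hd, hdTW, hh]
    exact isCoalgebraContraction_tMap hk
  have hdc := hC.codifferential_dN.toIsCoderivation
  have hδc : IsCoderivation (tGrading 𝓥) (tSign 𝓥) deconcat δ := by
    rw [hδ]
    exact hQ.sub hdc
  -- The differential `d` is built from the linear part of `Q`, so the two linear parts cancel.
  have hlin : linearPart δ = 0 := by
    refine LinearMap.ext fun v => ?_
    have h1 : tProj (d (tIncl v)) = linearPart Q v := by
      rw [hd, tDiff, tProj_tInsert, tProj_tIncl]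
    rw [linearPart, hδ, LinearMap.comp_apply, LinearMap.comp_apply, LinearMap.sub_apply, map_sub,
      h1]
    exact sub_self _
  have hlof := mem_tFilt_of_linearPart_eq_zero hδc.leibniz hlin
  have hlow : ∀ n, ∀ x ∈ tFilt (K := K) (V := V) (n + 1), δ x ∈ tFilt (K := K) (V := V) n :=
    fun n x hx => mem_tFilt_of_lof hlof hx
  have hhf : ∀ n, ∀ x ∈ tFilt (K := K) (V := V) n, h x ∈ tFilt (K := K) (V := V) n := by
    rw [hh]
    exact fun n x hx => tInsert_mem_tFilt 𝓥 _ _ hx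
  have hdδ : d + δ = Q := by
    rw [hδ]
    exact add_sub_cancel d Q
  have hnil : ∀ x, ∃ n, ((h ∘ₗ δ) ^ n) x = 0 :=
    pow_eq_zero_of_lowers fun n x hx => hhf _ _ (hlow n x hx)
  refine ⟨fun n t => ⟨insertPower 𝓥 LinearMap.id (linearPart Q) (n + 1) t, ?_⟩, fun n t =>
     mem_tFilt.1 (hlof n t), hC, ?_⟩
  · rw [hd]
    exact tInsert_lof 𝓥 _ _ n t
  obtain ⟨F, hsum, hF⟩ := exists_isPointwiseSum_pow hnil (tMap (K := K) ι)
  obtain ⟨hFhom, hDc, hPF⟩ := hC.perturbation hδc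
    (fun n x hx => tMap_mem_tFilt _ (tMap_mem_tFilt _ hx)) hhf hlow hsum hF
  have hsumD : IsPointwiseSum (fun n => tMap π ∘ₗ δ ∘ₗ ((h ∘ₗ δ) ^ n) ∘ₗ tMap ι)
      (tMap π ∘ₗ δ ∘ₗ F) := (hsum.comp_left δ).comp_left (tMap π)
  have hpow : ∀ n, ((δ ∘ₗ h) ^ n) ∘ₗ δ = δ ∘ₗ ((h ∘ₗ δ) ^ n) := fun n => by
    induction n with
    | zero => rfl
    | succ n ih => rw [pow_succ', pow_succ', Module.End.mul_eq_comp, Module.End.mul_eq_comp,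
        LinearMap.comp_assoc, ih]; rfl
  have hdW' := hC.codifferential_dM.toIsCoderivation
  -- Only here is symmetry needed for the chain map property: `F x` is symmetric, so `Q ∘ Q`
  -- vanishes at it.
  have hcomm : ∀ x ∈ SBar 𝓦, Q (F x) = F (dTW x + tMap π (δ (F x))) := fun x hx => by
    have h1 := hC.toIsContraction.perturbation_comm hnil hF (x := x)
    rw [hdδ] at h1
    exact h1 (hQS _ (hFhom.mem_SBar hx))
  refine ⟨F, tMap π ∘ₗ δ ∘ₗ F, hsum, hsumD, ?_, fun x hx => hdc.mem_SBar hx,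
    fun x hx => hδc.mem_SBar hx, fun x hx => hdW'.mem_SBar hx, fun x hx => hDc.mem_SBar hx,
    fun x hx => hFhom.mem_SBar hx, ?_, ?_, hFhom.restrict_SBar _, ?_⟩
  · refine fun x => ?_
    have h1 : ∀ n, tMap π ∘ₗ ((δ ∘ₗ h) ^ n) ∘ₗ δ ∘ₗ tMap ι =
        tMap π ∘ₗ δ ∘ₗ ((h ∘ₗ δ) ^ n) ∘ₗ tMap (K := K) ι := fun n => by
      rw [← LinearMap.comp_assoc (tMap ι) δ, hpow, LinearMap.comp_assoc]
    simp only [h1]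
    exact hsumD x
  · refine ⟨(hdc.restrict_SBar _).add (hδc.restrict_SBar _),
      LinearMap.ext fun x => Subtype.ext ?_⟩
    have h1 := hQS x x.2
    rw [← hdδ] at h1
    exact h1
  · refine ⟨(hdW'.restrict_SBar _).add (hDc.restrict_SBar _),
      LinearMap.ext fun x => Subtype.ext ?_⟩
    have hmem : dTW x + tMap π (δ (F x)) ∈ SBar 𝓦 :=
      Submodule.add_mem _ (hdW'.mem_SBar x.2) (hDc.mem_SBar x.2)
    have h1 := hQS (F x) (hFhom.mem_SBar x.2)
    -- Two applications of the intertwining relation give `F ((d + D)² x) = Q (Q (F x)) = 0`; then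
    -- `π F = id` removes `F`.
    rw [hcomm _ x.2, hcomm _ hmem] at h1
    have h2 := congrArg (tMap π) h1
    rw [hPF, map_zero] at h2
    exact h2
  · refine LinearMap.ext fun x => Subtype.ext ?_
    have h1 := hcomm x x.2
    rw [← hdδ] at h1
    exact h1
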